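/- Let $h_1,h_2,h_3\in\mathbb C$ with $h_1+h_2+h_3=0$, and put $\sigma_2=h_1h_2+h_1h_3+h_2h_3$, $\sigma_3=h_1h_2h_3$. Let $\mathcal Y$ be the affine Yangian of $\mathfrak{gl}(1)$ with $\psi_0=1$: the associative $\mathbb C$-algebra with generators $e_j,f_j,\psi_j$ ($j\ge 0$) and relations $\psi_0=1$, $[\psi_j,\psi_k]=0$, $[e_j,f_k]=\psi_{j+k}$, $$[x_{j+3},y_k]-3[x_{j+2},y_{k+1}]+3[x_{j+1},y_{k+2}]-[x_j,y_{k+3}]+\sigma_2[x_{j+1},y_k]-\sigma_2[x_j,y_{k+1}]\mp\sigma_3(x_jy_k+y_kx_j)=0$$ with sign $-$ for $(x,y)=(e,e),(\psi,e)$ and $+$ for $(x,y)=(f,f),(\psi,f)$, the boundary conditions $[\psi_0,e_j]=[\psi_1,e_j]=0$, $[\psi_2,e_j]=2e_j$, $[\psi_0,f_j]=[\psi_1,f_j]=0$, $[\psi_2,f_j]=-2f_j$, and the Serre relations $\mathrm{Sym}_{(j_1,j_2,j_3)}[e_{j_1},[e_{j_2},e_{j_3+1}]]=0=\mathrm{Sym}_{(j_1,j_2,j_3)}[f_{j_1},[f_{j_2},f_{j_3+1}]]$.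 Give $e_j,\psi_j,f_j$ the degrees $1,0,-1$, and let $\widehat{\mathcal Y}$ be the completion of $\mathcal Y$ for the topology in which the left ideals generated by the monomials of degree $\le -N$ ($N\ge0$) form a basis of neighbourhoods of $0$. For $n>0$ let $a_{n,1}=-\frac1{(n-1)!}\mathrm{ad}_{f_1}^{n-1}f_0$ and $a_{-n,1}=\frac1{(n-1)!}\mathrm{ad}_{e_1}^{n-1}e_0$, and let $a_{0,1}=\psi_1$ (a central element). For $n\ge2$ put $$a_{-n,2}=\frac1{(n-2)!}\mathrm{ad}_{e_1}^{n-2}\big([e_2,e_0]-\sigma_3[e_1,e_0]\big)-\sum_{i+j=-n}:a_{i,1}a_{j,1}:,$$ where in $:a_{i,1}a_{j,1}:$ a mode of nonnegative index stands to the right of a mode of negative index. (1) For every $n\ge 2$ the sum converges in $\widehat{\mathcal Y}$ and $$a_{-n,2}=\frac1{(n-2)!}\mathrm{ad}_{e_1}^{n-2}a_{-2,2}.$$ (2) If the terms containing $a_{0,1}$ are omitted from all these sums (so that $a_{-2,2}=[e_2,e_0]-\sigma_3[e_1,e_0]-e_0^2-2\sum_{k\ge1}a_{-(k+2),1}a_{k,1}$),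 then for every $n\ge2$ the sum converges and $$a_{-n,2}=\frac1{(n-2)!}\mathrm{ad}_{e_1}^{n-2}a_{-2,2}-2(n-2)\,\psi_1a_{-n,1};$$ in particular the identity of (1) holds for these elements wherever $\psi_1=0$. (3) Let $h_1,h_2$ be linearly independent over $\mathbb Z$. On the vector space with basis $|\pi\rangle$, $\pi$ running over the plane partitions (3D Young diagrams, boxes $\square=(x,y,z)$ with coordinates in $\mathbb Z_{\ge0}$, $h_\square=h_1y+h_2x+h_3z$), let $$e_j|\pi\rangle=\sum_{\square\in\pi^+}h_\square^jE(\pi\to\pi+\square)|\pi+\square\rangle,\quad f_j|\pi\rangle=-\sum_{\square\in\pi^-}h_\square^jE(\pi-\square\to\pi)|\pi-\square\rangle,\quad \Big(1+\sigma_3\sum_{j\ge0}\frac{\psi_j}{u^{j+1}}\Big)|\pi\rangle=\psi_\pi(u)|\pi\rangle,$$ where $\pi^+$ and $\pi^-$ are the sets of boxes that can be added to, respectively removed from, $\pi$, $$\psi_\pi(u)=\frac{u+\sigma_3}{u}\prod_{\square\in\pi}\varphi(u-h_\square),\qquad \varphi(u)=\frac{(u+h_1)(u+h_2)(u+h_3)}{(u-h_1)(u-h_2)(u-h_3)},$$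 and the square roots $E(\pi\to\pi+\square)=\sqrt{\sigma_3^{-1}\operatorname{res}_{u\to h_\square}\psi_\pi(u)}$ are chosen with coherent signs, i.e. $E(\pi\to\pi+\square)E(\pi\to\pi+\blacksquare)=E(\pi+\blacksquare\to\pi+\blacksquare+\square)E(\pi+\square\to\pi+\square+\blacksquare)$ for distinct $\square,\blacksquare\in\pi^+$. Let $P_{n,2}$ be the operator given by the formula for $a_{-n,2}$, and $p_{2,2}=P_{2,2}$. Then $\psi_1$ acts as $0$; for every $n\ge2$ only finitely many terms of the normally ordered sum are nonzero on any given vector; and $$P_{n,2}=\frac1{(n-2)!}\mathrm{ad}_{e_1}^{n-2}p_{2,2}.$$ -/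

import Mathlib

noncomputable section

namespace AffineYangian

open UniformSpace

/-! ### The affine Yangian of `𝔤𝔩(1)` by generators and relations -/

/-- `σ₂ = h₁h₂ + h₁h₃ + h₂h₃`. -/
def sigmaTwo (h₁ h₂ h₃ : ℂ) : ℂ := h₁ * h₂ + h₁ * h₃ + h₂ * h₃

/-- `σ₃ = h₁h₂h₃`. -/
def sigmaThree (h₁ h₂ h₃ : ℂ) : ℂ := h₁ * h₂ * h₃

/-- The generators `e_j`, `f_j`, `ψ_j`, `j = 0, 1, 2, …`. -/
inductive Gen : Type
  | e (j : ℕ)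
  | f (j : ℕ)
  | psi (j : ℕ)

namespace Gen

/-- The degree of a generator: `e_j ↦ 1`, `f_j ↦ -1`, `ψ_j ↦ 0`. All relations of the Yangian
are homogeneous. -/
def deg : Gen → ℤ
  | e _ => 1
  | f _ => -1
  | psi _ => 0

end Gen

/-- The free associative algebra on the generators. -/
abbrev Free : Type := FreeAlgebra ℂ Gen

/-- `e_j` in the free algebra. -/
def fe (j : ℕ) : Free := FreeAlgebra.ι ℂ (Gen.e j)

/-- `f_j` in the free algebra. -/
def ff (j : ℕ) : Free := FreeAlgebra.ι ℂ (Gen.f j)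

/-- `ψ_j` in the free algebra. -/
def fpsi (j : ℕ) : Free := FreeAlgebra.ι ℂ (Gen.psi j)

/-- The cubic expression
`[x_{j+3}, y_k] - 3[x_{j+2}, y_{k+1}] + 3[x_{j+1}, y_{k+2}] - [x_j, y_{k+3}]
  + σ₂[x_{j+1}, y_k] - σ₂[x_j, y_{k+1}] - s {x_j, y_k}`. -/
def cubic (s₂ s : ℂ) (x y : ℕ → Free) (j k : ℕ) : Free :=
  ⁅x (j + 3), y k⁆ - 3 * ⁅x (j + 2), y (k + 1)⁆ + 3 * ⁅x (j + 1), y (k + 2)⁆ - ⁅x j, y (k + 3)⁆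
    + s₂ • ⁅x (j + 1), y k⁆ - s₂ • ⁅x j, y (k + 1)⁆ - s • (x j * y k + y k * x j)

/-- The complete symmetrization (six terms) of `[x_{j₁}, [x_{j₂}, x_{j₃+1}]]`. -/
def serre (x : ℕ → Free) (j : Fin 3 → ℕ) : Free :=
  ∑ p : Equiv.Perm (Fin 3), ⁅x (j (p 0)), ⁅x (j (p 1)), x (j (p 2) + 1)⁆⁆

/-- The defining relations of the affine Yangian, with `ψ₀ = 1`. -/
inductive Rel (h₁ h₂ h₃ : ℂ) : Free → Free → Prop
  | psi_psi (j k : ℕ) : Rel h₁ h₂ h₃ ⁅fpsi j, fpsi k⁆ 0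
  | e_e (j k : ℕ) : Rel h₁ h₂ h₃ (cubic (sigmaTwo h₁ h₂ h₃) (sigmaThree h₁ h₂ h₃) fe fe j k) 0
  | f_f (j k : ℕ) : Rel h₁ h₂ h₃ (cubic (sigmaTwo h₁ h₂ h₃) (-sigmaThree h₁ h₂ h₃) ff ff j k) 0
  | e_f (j k : ℕ) : Rel h₁ h₂ h₃ ⁅fe j, ff k⁆ (fpsi (j + k))
  | psi_e (j k : ℕ) :
      Rel h₁ h₂ h₃ (cubic (sigmaTwo h₁ h₂ h₃) (sigmaThree h₁ h₂ h₃) fpsi fe j k) 0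
  | psi_f (j k : ℕ) :
      Rel h₁ h₂ h₃ (cubic (sigmaTwo h₁ h₂ h₃) (-sigmaThree h₁ h₂ h₃) fpsi ff j k) 0
  | psi_zero_e (j : ℕ) : Rel h₁ h₂ h₃ ⁅fpsi 0, fe j⁆ 0
  | psi_one_e (j : ℕ) : Rel h₁ h₂ h₃ ⁅fpsi 1, fe j⁆ 0
  | psi_two_e (j : ℕ) : Rel h₁ h₂ h₃ ⁅fpsi 2, fe j⁆ (2 * fe j)
  | psi_zero_f (j : ℕ) : Rel h₁ h₂ h₃ ⁅fpsi 0, ff j⁆ 0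
  | psi_one_f (j : ℕ) : Rel h₁ h₂ h₃ ⁅fpsi 1, ff j⁆ 0
  | psi_two_f (j : ℕ) : Rel h₁ h₂ h₃ ⁅fpsi 2, ff j⁆ (-2 * ff j)
  | serre_e (j : Fin 3 → ℕ) : Rel h₁ h₂ h₃ (serre fe j) 0
  | serre_f (j : Fin 3 → ℕ) : Rel h₁ h₂ h₃ (serre ff j) 0
  | psi_zero : Rel h₁ h₂ h₃ (fpsi 0) 1

/-- The affine Yangian of `𝔤𝔩(1)` with parameters `h₁, h₂, h₃` and `ψ₀ = 1`. -/
def Yangian (h₁ h₂ h₃ : ℂ) : Type := RingQuot (Rel h₁ h₂ h₃)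

variable (h₁ h₂ h₃ : ℂ)

instance : Ring (Yangian h₁ h₂ h₃) := inferInstanceAs (Ring (RingQuot (Rel h₁ h₂ h₃)))

instance : Algebra ℂ (Yangian h₁ h₂ h₃) :=
  inferInstanceAs (Algebra ℂ (RingQuot (Rel h₁ h₂ h₃)))

/-- The quotient map from the free algebra. -/
def toYangian : Free →ₐ[ℂ] Yangian h₁ h₂ h₃ := RingQuot.mkAlgHom ℂ (Rel h₁ h₂ h₃)

/-! ### The completion in which normally ordered sums converge -/

/-- The left ideal generated by the monomials of degree at most `-N` in the generators. -/
def lowIdeal (N : ℕ) : Ideal (Yangian h₁ h₂ h₃) :=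
  Ideal.span {x | ∃ w : List Gen, (w.map Gen.deg).sum ≤ -(N : ℤ) ∧
    x = toYangian h₁ h₂ h₃ (w.map (FreeAlgebra.ι ℂ)).prod}

theorem lowIdeal_anti {M N : ℕ} (h : M ≤ N) : lowIdeal h₁ h₂ h₃ N ≤ lowIdeal h₁ h₂ h₃ M := by
  apply Ideal.span_mono
  rintro x ⟨w, hw, rfl⟩
  exact ⟨w, by omega, rfl⟩

theorem lowIdeal_mul_right (x : Free) (N : ℕ) : ∃ M : ℕ, ∀ y ∈ lowIdeal h₁ h₂ h₃ M,
    y * toYangian h₁ h₂ h₃ x ∈ lowIdeal h₁ h₂ h₃ N := by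
  induction x using FreeAlgebra.induction generalizing N with
  | grade0 r =>
    refine ⟨N, fun y hy => ?_⟩
    rw [AlgHom.commutes, ← Algebra.commutes]
    exact Ideal.mul_mem_left _ _ hy
  | grade1 g =>
    refine ⟨N + 1, fun y hy => ?_⟩
    induction hy using Submodule.span_induction with
    | mem y hy =>
      obtain ⟨w, hw, rfl⟩ := hy
      refine Ideal.subset_span ⟨w ++ [g], ?_, by simp⟩
      have : g.deg ≤ 1 := by cases g <;> simp [Gen.deg]
      push_cast at hw
      simp only [List.map_append, List.map_cons, List.map_nil, List.sum_append, List.sum_cons,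
        List.sum_nil]
      omega
    | zero => simp
    | add a b _ _ ha hb => rw [add_mul]; exact Ideal.add_mem _ ha hb
    | smul a b _ hb => rw [smul_eq_mul, mul_assoc]; exact Ideal.mul_mem_left _ _ hb
  | mul a b ha hb =>
    obtain ⟨M, hM⟩ := hb N
    obtain ⟨K, hK⟩ := ha M
    refine ⟨K, fun y hy => ?_⟩
    rw [map_mul, ← mul_assoc]
    exact hM _ (hK _ hy)
  | add a b ha hb =>
    obtain ⟨M, hM⟩ := ha N
    obtain ⟨K, hK⟩ := hb N
    refine ⟨max M K, fun y hy => ?_⟩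
    rw [map_add, mul_add]
    exact Ideal.add_mem _ (hM _ (lowIdeal_anti _ _ _ (le_max_left _ _) hy))
      (hK _ (lowIdeal_anti _ _ _ (le_max_right _ _) hy))

theorem lowIdeal_basis :
    RingSubgroupsBasis fun N : ℕ => (lowIdeal h₁ h₂ h₃ N).toAddSubgroup where
  inter i j := ⟨max i j, le_inf (lowIdeal_anti _ _ _ (le_max_left i j))
    (lowIdeal_anti _ _ _ (le_max_right i j))⟩
  mul i := by
    refine ⟨i, ?_⟩
    rintro _ ⟨a, _, b, hb, rfl⟩
    exact Ideal.mul_mem_left _ a hb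
  leftMul x i := ⟨i, fun _ hy => Ideal.mul_mem_left _ x hy⟩
  rightMul x i := by
    obtain ⟨x, rfl⟩ := RingQuot.mkAlgHom_surjective ℂ (Rel h₁ h₂ h₃) x
    exact lowIdeal_mul_right h₁ h₂ h₃ x i

/-- The ring topology on the Yangian in which the left ideals `lowIdeal N` form a basis of
neighbourhoods of zero. -/
instance : TopologicalSpace (Yangian h₁ h₂ h₃) := (lowIdeal_basis h₁ h₂ h₃).topology

instance : IsTopologicalRing (Yangian h₁ h₂ h₃) :=
  (lowIdeal_basis h₁ h₂ h₃).toRingFilterBasis.isTopologicalRing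

instance : UniformSpace (Yangian h₁ h₂ h₃) :=
  IsTopologicalAddGroup.rightUniformSpace (Yangian h₁ h₂ h₃)

instance : IsUniformAddGroup (Yangian h₁ h₂ h₃) := isUniformAddGroup_of_addCommGroup

instance : UniformContinuousConstSMul ℂ (Yangian h₁ h₂ h₃) where
  uniformContinuous_const_smul c := by
    have : (fun x : Yangian h₁ h₂ h₃ => c • x) = AddMonoidHom.mulLeft (algebraMap ℂ _ c) := by
      ext x; simp [Algebra.smul_def]
    show UniformContinuous fun x : Yangian h₁ h₂ h₃ => c • x
    rw [this]
    exact uniformContinuous_addMonoidHom_of_continuous (continuous_const_mul _)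

/-- The completed affine Yangian: a complete Hausdorff topological `ℂ`-algebra. -/
abbrev CompletedYangian : Type := Completion (Yangian h₁ h₂ h₃)

namespace CompletedYangian

/-- `e_j` in the completed Yangian. -/
def e (j : ℕ) : CompletedYangian h₁ h₂ h₃ := (toYangian h₁ h₂ h₃ (fe j) : Yangian h₁ h₂ h₃)

/-- `f_j` in the completed Yangian. -/
def f (j : ℕ) : CompletedYangian h₁ h₂ h₃ := (toYangian h₁ h₂ h₃ (ff j) : Yangian h₁ h₂ h₃)

/-- `ψ_j` in the completed Yangian. -/
def psi (j : ℕ) : CompletedYangian h₁ h₂ h₃ := (toYangian h₁ h₂ h₃ (fpsi j) : Yangian h₁ h₂ h₃)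

end CompletedYangian

/-! ### Bosons, in any algebra with elements `e_j`, `f_j` -/

section Bosons

variable {A : Type*} [Ring A] [Algebra ℂ A]

/-- `ad_x^n y`. -/
def adPow (x : A) (n : ℕ) (y : A) : A := (fun t => ⁅x, t⁆)^[n] y

/-- The modes `a_{i,1}`, `i ∈ ℤ`: for `n > 0`, `a_{n,1} = -ad_{f₁}^{n-1} f₀ / (n-1)!` and
`a_{-n,1} = ad_{e₁}^{n-1} e₀ / (n-1)!`; the zero mode `a_{0,1}` is the argument `z`. -/
def bosonOne (e f : ℕ → A) (z : A) : ℤ → A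
  | .ofNat 0 => z
  | .ofNat (n + 1) => -((n.factorial : ℂ)⁻¹ • adPow (f 1) n (f 0))
  | .negSucc n => (n.factorial : ℂ)⁻¹ • adPow (e 1) n (e 0)

/-- The normally ordered product `:a_i a_j:`, where a mode of nonnegative index stands to the
right of a mode of negative index. -/
def normalOrdered (a : ℤ → A) (i j : ℤ) : A :=
  if 0 ≤ i ∧ j < 0 then a j * a i else a i * a j

/-- `ad_{e₁}^{n-2} ([e₂,e₀] - σ₃[e₁,e₀]) / (n-2)!`, for `n ≥ 2`. -/
def linearPart (s₃ : ℂ) (e : ℕ → A) (n : ℕ) : A :=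
  ((n - 2).factorial : ℂ)⁻¹ • adPow (e 1) (n - 2) (⁅e 2, e 0⁆ - s₃ • ⁅e 1, e 0⁆)

end Bosons

/-- The spin-two boson `a_{-n,2}` in the completed Yangian, for `n ≥ 2`, with zero mode
`a_{0,1} = z`:
`ad_{e₁}^{n-2} ([e₂,e₀] - σ₃[e₁,e₀]) / (n-2)! - ∑_{i+j=-n} :a_{i,1} a_{j,1}:`. -/
def spinTwo (z : CompletedYangian h₁ h₂ h₃) (n : ℕ) : CompletedYangian h₁ h₂ h₃ :=
  linearPart (sigmaThree h₁ h₂ h₃) (CompletedYangian.e h₁ h₂ h₃) n -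
    ∑' i : ℤ, normalOrdered
      (bosonOne (CompletedYangian.e h₁ h₂ h₃) (CompletedYangian.f h₁ h₂ h₃) z) i (-(n : ℤ) - i)

/-! ### Plane partitions (3D Young diagrams) -/

/-- A box `(x, y, z)`, with coordinates starting at `0`. -/
abbrev Box : Type := ℕ × ℕ × ℕ

/-- A plane partition, as a 3D Young diagram: a finite set of boxes closed under decreasing
coordinates. -/
@[ext]
structure PlanePartition where
  cells : Finset Box
  isLowerSet : IsLowerSet (cells : Set Box)

namespace PlanePartition

/-- `b ∈ π⁺`: the box `b` is not in `π` and can be added to `π`. -/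
def Addable (π : PlanePartition) (b : Box) : Prop :=
  b ∉ π.cells ∧ IsLowerSet ((insert b π.cells : Finset Box) : Set Box)

/-- `b ∈ π⁻`: the box `b` is in `π` and can be removed from `π`. -/
def Removable (π : PlanePartition) (b : Box) : Prop :=
  b ∈ π.cells ∧ IsLowerSet ((π.cells.erase b : Finset Box) : Set Box)

open Classical in
/-- `π + b` (equal to `π` by convention if this is not a 3D Young diagram). -/
def add (π : PlanePartition) (b : Box) : PlanePartition :=
  if h : IsLowerSet ((insert b π.cells : Finset Box) : Set Box) then ⟨insert b π.cells, h⟩ else π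

open Classical in
/-- `π - b` (equal to `π` by convention if this is not a 3D Young diagram). -/
def remove (π : PlanePartition) (b : Box) : PlanePartition :=
  if h : IsLowerSet ((π.cells.erase b : Finset Box) : Set Box) then ⟨π.cells.erase b, h⟩ else π

theorem finite_addable (π : PlanePartition) : {b | π.Addable b}.Finite := by
  refine Set.Finite.subset (s := (({(0, 0, 0)} ∪ π.cells.image (fun b => (b.1 + 1, b.2.1, b.2.2)) ∪
    π.cells.image (fun b => (b.1, b.2.1 + 1, b.2.2)) ∪
    π.cells.image (fun b => (b.1, b.2.1, b.2.2 + 1)) : Finset Box) : Set Box))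
    (Finset.finite_toSet _) ?_
  rintro ⟨x, y, z⟩ ⟨_, hl⟩
  have key : ∀ c : Box, c ≤ (x, y, z) → c ≠ (x, y, z) → c ∈ π.cells := by
    intro c hc hne
    have := hl hc (by simp)
    simpa [hne] using this
  simp only [Finset.coe_union, Finset.coe_singleton, Finset.coe_image, Set.mem_union,
    Set.mem_singleton_iff, Set.mem_image, Finset.mem_coe]
  rcases x with _ | x
  · rcases y with _ | y
    · rcases z with _ | z
      · simp
      · exact Or.inr ⟨(0, 0, z), key _ (by simp [Prod.le_def]) (by simp), rfl⟩
    · exact Or.inl (Or.inr ⟨(0, y, z), key _ (by simp [Prod.le_def]) (by simp), rfl⟩)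
  · exact Or.inl (Or.inl (Or.inr ⟨(x, y, z), key _ (by simp [Prod.le_def]) (by simp), rfl⟩))

theorem finite_removable (π : PlanePartition) : {b | π.Removable b}.Finite :=
  Set.Finite.subset (Finset.finite_toSet π.cells) fun _ hb => hb.1

/-- The finite set `π⁺`. -/
def addableBoxes (π : PlanePartition) : Finset Box := π.finite_addable.toFinset

/-- The finite set `π⁻`. -/
def removableBoxes (π : PlanePartition) : Finset Box := π.finite_removable.toFinset

end PlanePartition

/-- `h_b = h₁ y + h₂ x + h₃ z` for the box `b = (x, y, z)`. -/
def boxWeight (b : Box) : ℂ := h₁ * b.2.1 + h₂ * b.1 + h₃ * b.2.2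

/-- `φ(u) = (u+h₁)(u+h₂)(u+h₃) / ((u-h₁)(u-h₂)(u-h₃))`, for `u` in the field of formal Laurent
series, which allows one to expand `φ` at any point of the projective line. -/
def phi (u : LaurentSeries ℂ) : LaurentSeries ℂ :=
  ((u + HahnSeries.C h₁) * (u + HahnSeries.C h₂) * (u + HahnSeries.C h₃)) /
    ((u - HahnSeries.C h₁) * (u - HahnSeries.C h₂) * (u - HahnSeries.C h₃))

/-- `ψ_π(u) = ((u + σ₃) / u) ∏_{b ∈ π} φ(u - h_b)`, for a formal Laurent series `u`. -/
def psiFun (π : PlanePartition) (u : LaurentSeries ℂ) : LaurentSeries ℂ :=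
  (u + HahnSeries.C (sigmaThree h₁ h₂ h₃)) / u *
    ∏ b ∈ π.cells, phi h₁ h₂ h₃ (u - HahnSeries.C (boxWeight h₁ h₂ h₃ b))

/-- `res_{u → a} ψ_π(u)`: the coefficient of `t⁻¹` in the Laurent expansion of `ψ_π(a + t)`. -/
def residue (π : PlanePartition) (a : ℂ) : ℂ :=
  (psiFun h₁ h₂ h₃ π (HahnSeries.C a + HahnSeries.single 1 1)).coeff (-1)

/-- The eigenvalue of `ψ_j` on `|π⟩`, read off from the expansion at infinity
`ψ_π(u) = 1 + σ₃ ∑_j ψ_j u^{-j-1}`, with `u = t⁻¹`. -/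
def psiEigenvalue (π : PlanePartition) (j : ℕ) : ℂ :=
  (sigmaThree h₁ h₂ h₃)⁻¹ *
    (psiFun h₁ h₂ h₃ π (HahnSeries.single (-1) 1)).coeff ((j : ℤ) + 1)

/-- `E π b` is a choice of the square root
`E(π → π + b) = √(res_{u → h_b} ψ_π(u) / σ₃)` for all `π` and all `b ∈ π⁺`, with coherent signs:
both sides of `coherent` have the same square for generic parameters, so that this condition
concerns only the branches of the square roots. It says that the coefficients of
`|π + b⟩` in `e_j f_k |π + c⟩` and `f_k e_j |π + c⟩` agree. -/
structure IsRootChoice (E : PlanePartition → Box → ℂ) : Prop where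
  sq : ∀ π b, π.Addable b →
    E π b ^ 2 = (sigmaThree h₁ h₂ h₃)⁻¹ * residue h₁ h₂ h₃ π (boxWeight h₁ h₂ h₃ b)
  coherent : ∀ π b c, π.Addable b → π.Addable c → b ≠ c →
    E π b * E π c = E (π.add c) b * E (π.add b) c

/-- The space with basis `|π⟩`, `π` a plane partition. -/
abbrev PPSpace : Type := PlanePartition →₀ ℂ

/-- The basis vector `|π⟩`. -/
def ket (π : PlanePartition) : PPSpace := Finsupp.single π 1

/-- `e_j |π⟩ = ∑_{b ∈ π⁺} h_b^j E(π → π + b) |π + b⟩`. -/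
def ppE (E : PlanePartition → Box → ℂ) (j : ℕ) : Module.End ℂ PPSpace :=
  Finsupp.linearCombination ℂ fun π =>
    ∑ b ∈ π.addableBoxes, (boxWeight h₁ h₂ h₃ b ^ j * E π b) • ket (π.add b)

/-- `f_j |π⟩ = ∑_{b ∈ π⁻} h_b^j F(π → π - b) |π - b⟩` with `F(π → π - b) = -E(π - b → π)`. -/
def ppF (E : PlanePartition → Box → ℂ) (j : ℕ) : Module.End ℂ PPSpace :=
  Finsupp.linearCombination ℂ fun π =>
    ∑ b ∈ π.removableBoxes, (boxWeight h₁ h₂ h₃ b ^ j * (-E (π.remove b) b)) • ket (π.remove b)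

/-- `ψ_j |π⟩`, given by `ψ(u) |π⟩ = ψ_π(u) |π⟩`. -/
def ppPsi (j : ℕ) : Module.End ℂ PPSpace :=
  Finsupp.linearCombination ℂ fun π => psiEigenvalue h₁ h₂ h₃ π j • ket π

/-- The operator of `a_{i,1}` on plane partitions, with `a_{0,1} = ψ₁`. -/
def ppBosonOne (E : PlanePartition → Box → ℂ) : ℤ → Module.End ℂ PPSpace :=
  bosonOne (ppE h₁ h₂ h₃ E) (ppF h₁ h₂ h₃ E) (ppPsi h₁ h₂ h₃ 1)

/-- The operator `P_{n,2}` of `a_{-n,2}` on plane partitions, for `n ≥ 2`. On each vector only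
finitely many terms of the normally ordered sum are nonzero. -/
def ppSpinTwo (E : PlanePartition → Box → ℂ) (n : ℕ) : Module.End ℂ PPSpace :=
  linearPart (sigmaThree h₁ h₂ h₃) (ppE h₁ h₂ h₃ E) n -
    Finsupp.linearCombination ℂ fun π =>
      ∑ᶠ i : ℤ, normalOrdered (ppBosonOne h₁ h₂ h₃ E) i (-(n : ℤ) - i) (ket π)

end AffineYangian

end

noncomputable section

namespace AffineYangian

open UniformSpace

/-! ### Commutators of `e 1` with the modes and their normally ordered products -/

section

section Bosons

section Ring

variable {A : Type*} [Ring A]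

/-! Everything rests on one formula: $[e_1, a_{m,1}] = -m\,a_{m-1,1}$ for every integer $m$
(`lie_bosonOne`). For negative $m$ it is built into the definition of the modes. For $m \ge 2$ it is
an $\mathfrak{sl}_2$ computation with the triple $e_1, f_1, \psi_2$. At $m = 1$ it reads $[e_1,-f_0]
= -\psi_1$, which forces $a_{0,1} = \psi_1$, and at $m = 0$ it says that $e_1$ commutes with
$\psi_1$. Thus $\mathrm{ad}_{e_1}$ acts on the modes as $d/dw$ acts on the coefficients of a field.

As $\mathrm{ad}_{e_1}$ is a derivation, it sends $:a_i a_j:$ to $-i:a_{i-1}a_j: - j:a_i a_{j-1}:$;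
the one place where the ordering could break carries the coefficient $0$ (`lie_normalOrdered`).
Summing over $i+j=-n$, the coefficient of each term with total index $-n-1$ is $n-1$
(`tsum_shift_sub`). The linear part obeys the same recursion, so $[e_1,a_{-n,2}] = (n-1)a_{-n-1,2}$,
and iteration from $n=2$ gives the factorial formula (`eq_inv_factorial_smul_adPow`).

The sums converge in the completion because normal ordering puts a lowering mode of large index on
the right, so the terms enter every left ideal `lowIdeal N`. Omitting $a_{0,1}$ changes the sum by
exactly $2\psi_1a_{-n,1}$. This correction does not follow the recursion, and its defect is the term
$-2(n-2)\psi_1a_{-n,1}$.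

On plane partitions only the few relations in `ModeRelations` are needed. The main one is
$[e_j,f_k]=\psi_{j+k}$ (`bracket_ppE_ppF`): terms that move a box cancel by coherence of the signs,
and the diagonal terms add up to $\sigma_3^{-1}\sum h_\square^{j+k}\operatorname{res}\psi_\pi$ over
addable and removable boxes, which is the eigenvalue of $\psi_{j+k}$ by the residue theorem. The
theorem applies because all poles of $\psi_\pi$ are simple and sit at such boxes (`diagCount_le`).
Expansion at infinity gives the eigenvalues $\psi_1=0$ and $\psi_2=2|\pi|$; the latter grading also
makes the normally ordered sums finite on each vector. -/

theorem adPow_zero (x y : A) : adPow x 0 y = y := rfl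

theorem adPow_succ (x : A) (n : ℕ) (y : A) : adPow x (n + 1) y = ⁅x, adPow x n y⁆ :=
  Function.iterate_succ_apply' _ _ _

theorem bracket_mul (x y z : A) : ⁅x, y * z⁆ = ⁅x, y⁆ * z + y * ⁅x, z⁆ := by
  simp only [Ring.lie_def]; noncomm_ring

theorem leibniz_bracket (x y z : A) : ⁅x, ⁅y, z⁆⁆ = ⁅⁅x, y⁆, z⁆ + ⁅y, ⁅x, z⁆⁆ := by
  simp only [Ring.lie_def]; noncomm_ring

theorem bracket_neg (x y : A) : ⁅x, -y⁆ = -⁅x, y⁆ := by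
  simp only [Ring.lie_def]; noncomm_ring

theorem bracket_sub (x y z : A) : ⁅x, y - z⁆ = ⁅x, y⁆ - ⁅x, z⁆ := by
  simp only [Ring.lie_def]; noncomm_ring

end Ring

variable {A : Type*} [Ring A] [Algebra ℂ A]

theorem bracket_smul (x y : A) (c : ℂ) : ⁅x, c • y⁆ = c • ⁅x, y⁆ := by
  simp only [Ring.lie_def, mul_smul_comm, smul_mul_assoc, smul_sub]

/-- A sequence on which `ad_x` acts like the derivative on monomials is determined by its first
term. -/
theorem eq_inv_factorial_smul_adPow {x : A} {B : ℕ → A}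
    (h : ∀ k : ℕ, ⁅x, B k⁆ = ((k : ℂ) + 1) • B (k + 1)) (k : ℕ) :
    B k = (k.factorial : ℂ)⁻¹ • adPow x k (B 0) := by
  induction k with
  | zero => simp [adPow_zero]
  | succ k ih =>
    have hk : ((k : ℂ) + 1) ≠ 0 := Nat.cast_add_one_ne_zero k
    have h1 : B (k + 1) = ((k : ℂ) + 1)⁻¹ • ⁅x, B k⁆ := by rw [h, inv_smul_smul₀ hk]
    rw [h1, ih, bracket_smul, adPow_succ, smul_smul, Nat.factorial_succ]
    push_cast
    rw [mul_inv]

theorem lie_inv_factorial_smul_adPow (x y : A) (k : ℕ) :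
    ⁅x, (k.factorial : ℂ)⁻¹ • adPow x k y⁆ =
      ((k : ℂ) + 1) • ((k + 1).factorial : ℂ)⁻¹ • adPow x (k + 1) y := by
  have hk : ((k : ℂ) + 1) ≠ 0 := Nat.cast_add_one_ne_zero k
  rw [bracket_smul, adPow_succ, smul_smul, Nat.factorial_succ]
  push_cast
  rw [mul_inv, mul_inv_cancel_left₀ hk]

/-- The part of the relations of the Yangian which involves `e₁`: the elements `e₁, f₁, ψ₂` form
an `𝔰𝔩₂`-triple, `f₀` is a weight vector, and `[e₁, f₀] = z` commutes with `e₁` and `f₁`. -/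
structure ModeRelations (e f : ℕ → A) (z h : A) : Prop where
  e_f_zero : ⁅e 1, f 0⁆ = z
  e_f_one : ⁅e 1, f 1⁆ = h
  h_f_zero : ⁅h, f 0⁆ = (-2 : ℂ) • f 0
  h_f_one : ⁅h, f 1⁆ = (-2 : ℂ) • f 1
  e_z : ⁅e 1, z⁆ = 0
  f_z : ⁅f 1, z⁆ = 0

namespace ModeRelations

variable {e f : ℕ → A} {z h : A}

theorem lie_h_adPow (H : ModeRelations e f z h) (k : ℕ) :
    ⁅h, adPow (f 1) k (f 0)⁆ = (-2 * ((k : ℂ) + 1)) • adPow (f 1) k (f 0) := by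
  induction k with
  | zero => simpa [adPow_zero] using H.h_f_zero
  | succ k ih =>
    rw [adPow_succ, leibniz_bracket, ih, H.h_f_one, bracket_smul, Ring.lie_def, smul_mul_assoc,
      mul_smul_comm, ← smul_sub, ← Ring.lie_def, ← add_smul]
    push_cast
    ring_nf

/-- The usual $\mathfrak{sl}_2$ induction from a vector of weight $-2$: commuting `e 1` past one `f
1` produces the weight $-2(k+1)$ of the previous vector, and the weights add up to $-(k+1)(k+2)$. It
starts because $[e_1,f_0]=z$ is killed by `f 1`. -/
theorem lie_e_adPow (H : ModeRelations e f z h) (k : ℕ) :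
    ⁅e 1, adPow (f 1) (k + 1) (f 0)⁆ =
      (-(((k : ℂ) + 1) * ((k : ℂ) + 2))) • adPow (f 1) k (f 0) := by
  induction k with
  | zero =>
    rw [adPow_succ, leibniz_bracket, H.e_f_one, adPow_zero, H.e_f_zero, H.f_z, H.h_f_zero]
    simp
  | succ k ih =>
    rw [adPow_succ, leibniz_bracket, ih, H.e_f_one, H.lie_h_adPow, bracket_smul, ← adPow_succ,
      ← add_smul]
    push_cast
    ring_nf

theorem lie_bosonOne (H : ModeRelations e f z h) (m : ℤ) :
    ⁅e 1, bosonOne e f z m⁆ = (-(m : ℂ)) • bosonOne e f z (m - 1) := by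
  rcases m with (_ | _ | k) | k
  · simpa [bosonOne] using H.e_z
  -- Index $1$: the bracket lands on the zero mode itself, so `z` must be $[e_1,f_0]$.
  · show ⁅e 1, -(((0 : ℕ).factorial : ℂ)⁻¹ • adPow (f 1) 0 (f 0))⁆ = _ • z
    rw [bracket_neg, bracket_smul, adPow_zero, H.e_f_zero]
    simp
  · have : Int.ofNat (k + 1 + 1) - 1 = Int.ofNat (k + 1) := by simp
    rw [this]
    show ⁅e 1, -(((k + 1).factorial : ℂ)⁻¹ • adPow (f 1) (k + 1) (f 0))⁆ =
      _ • -((k.factorial : ℂ)⁻¹ • adPow (f 1) k (f 0))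
    have hk : ((k : ℂ) + 1) ≠ 0 := Nat.cast_add_one_ne_zero k
    have hf : (k.factorial : ℂ) ≠ 0 := Nat.cast_ne_zero.2 k.factorial_ne_zero
    rw [bracket_neg, bracket_smul, H.lie_e_adPow, smul_smul, smul_neg, smul_smul,
      Nat.factorial_succ]
    congr 2
    push_cast
    field_simp
    ring_nf
    simp
    ring
  · have : Int.negSucc k - 1 = Int.negSucc (k + 1) := rfl
    rw [this]
    show ⁅e 1, (k.factorial : ℂ)⁻¹ • adPow (e 1) k (e 0)⁆ =
      _ • ((k + 1).factorial : ℂ)⁻¹ • adPow (e 1) (k + 1) (e 0)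
    rw [lie_inv_factorial_smul_adPow]
    simp [Int.negSucc_eq]

/-- Since `i + j < 0`, at most one index is nonnegative. Lowering an index changes the prescribed
order only when $0$ becomes $-1$, and then the coefficient is $0$. -/
theorem lie_normalOrdered (H : ModeRelations e f z h) {i j : ℤ} (hij : i + j < 0) :
    ⁅e 1, normalOrdered (bosonOne e f z) i j⁆ =
      (-(i : ℂ)) • normalOrdered (bosonOne e f z) (i - 1) j +
        (-(j : ℂ)) • normalOrdered (bosonOne e f z) i (j - 1) := by
  by_cases hi : 0 ≤ i
  · have hj : j < 0 := by omega
    have h2 : normalOrdered (bosonOne e f z) i (j - 1) =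
        bosonOne e f z (j - 1) * bosonOne e f z i := if_pos ⟨hi, by omega⟩
    -- For `i = 0` the two products have opposite orders, but both sides vanish.
    have h3 : (-(i : ℂ)) • normalOrdered (bosonOne e f z) (i - 1) j =
        (-(i : ℂ)) • (bosonOne e f z j * bosonOne e f z (i - 1)) := by
      rcases hi.eq_or_lt with rfl | hi
      · simp
      · rw [normalOrdered, if_pos ⟨by omega, hj⟩]
    rw [h2, h3, normalOrdered, if_pos ⟨hi, hj⟩, bracket_mul, H.lie_bosonOne, H.lie_bosonOne,
      smul_mul_assoc, mul_smul_comm, add_comm]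
  · have h (i' j' : ℤ) (h' : i' < 0) : normalOrdered (bosonOne e f z) i' j' =
        bosonOne e f z i' * bosonOne e f z j' := if_neg (by omega)
    rw [h _ _ (by omega), h _ _ (by omega), h _ _ (by omega), bracket_mul, H.lie_bosonOne,
      H.lie_bosonOne, smul_mul_assoc, mul_smul_comm]

end ModeRelations

theorem lie_linearPart (s : ℂ) (e : ℕ → A) (k : ℕ) :
    ⁅e 1, linearPart s e (k + 2)⁆ = ((k : ℂ) + 1) • linearPart s e (k + 1 + 2) :=
  lie_inv_factorial_smul_adPow _ _ k

end Bosons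

/-- The sum over `i` of the derivative of `F i (−n−i)`, after collecting equal terms. -/
theorem tsum_shift_sub {X : Type*} [AddCommGroup X] [Module ℂ X] [TopologicalSpace X]
    [IsTopologicalAddGroup X] [ContinuousConstSMul ℂ X] [T2Space X] {F : ℤ → X}
    (hF : ∀ c : ℤ → ℂ, Summable fun i => c i • F i) (n : ℂ) :
    ∑' i : ℤ, ((-(i : ℂ)) • F (i - 1) + (n + i) • F i) = (n - 1) • ∑' i, F i := by
  have h1 : Summable fun i : ℤ => (-(i : ℂ)) • F (i - 1) := by
    have := (Equiv.subRight (1 : ℤ)).summable_iff.2 (hF fun i => -((i : ℂ) + 1))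
    refine this.congr fun i => ?_
    simp only [Function.comp_apply, Equiv.subRight_apply]
    push_cast
    ring_nf
  have h2 : ∑' i : ℤ, (-(i : ℂ)) • F (i - 1) = ∑' i : ℤ, (-((i : ℂ) + 1)) • F i := by
    rw [← (Equiv.subRight (1 : ℤ)).tsum_eq fun i : ℤ => (-((i : ℂ) + 1)) • F i]
    refine tsum_congr fun i => ?_
    simp only [Equiv.subRight_apply]
    push_cast
    ring_nf
  -- After the shift the coefficient of `F i` is $-(i+1)+(n+i)=n-1$, independent of $i$.
  rw [h1.tsum_add (hF _), h2, ← (hF _).tsum_add (hF _), ← tsum_const_smul'' (n - 1)]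
  refine tsum_congr fun i => ?_
  rw [← add_smul]
  ring_nf

end

/-! ### The completed Yangian: convergence, the recursion, and the effect of the zero mode -/

section

section Map

variable {A B : Type*} [Ring A] [Algebra ℂ A] [Ring B] [Algebra ℂ B] (φ : A →ₐ[ℂ] B)

theorem map_bracket (x y : A) : φ ⁅x, y⁆ = ⁅φ x, φ y⁆ := by
  simp only [Ring.lie_def, map_sub, map_mul]

theorem map_adPow (x : A) (n : ℕ) (y : A) : φ (adPow x n y) = adPow (φ x) n (φ y) := by
  induction n with
  | zero => rfl
  | succ n ih => rw [adPow_succ, adPow_succ, map_bracket, ih]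

theorem map_bosonOne (e f : ℕ → A) (z : A) (i : ℤ) :
    φ (bosonOne e f z i) = bosonOne (φ ∘ e) (φ ∘ f) (φ z) i := by
  rcases i with (_ | k) | k
  · rfl
  · simp [bosonOne, map_adPow]
  · simp [bosonOne, map_adPow]

theorem map_normalOrdered (a : ℤ → A) (i j : ℤ) :
    φ (normalOrdered a i j) = normalOrdered (φ ∘ a) i j := by
  unfold normalOrdered
  split_ifs <;> simp

end Map

variable (h₁ h₂ h₃ : ℂ)

/-- The span of the monomials of degree at most `-N`. -/
def lowSpan (N : ℕ) : Submodule ℂ (Yangian h₁ h₂ h₃) :=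
  Submodule.span ℂ {x | ∃ w : List Gen, (w.map Gen.deg).sum ≤ -(N : ℤ) ∧
    x = toYangian h₁ h₂ h₃ (w.map (FreeAlgebra.ι ℂ)).prod}

theorem lowIdeal_smul_mem {N : ℕ} (c : ℂ) {x : Yangian h₁ h₂ h₃} (hx : x ∈ lowIdeal h₁ h₂ h₃ N) :
    c • x ∈ lowIdeal h₁ h₂ h₃ N := by
  rw [Algebra.smul_def]
  exact Ideal.mul_mem_left _ _ hx

theorem lowSpan_subset {N : ℕ} {x : Yangian h₁ h₂ h₃} (hx : x ∈ lowSpan h₁ h₂ h₃ N) :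
    x ∈ lowIdeal h₁ h₂ h₃ N := by
  induction hx using Submodule.span_induction with
  | mem x hx => exact Ideal.subset_span hx
  | zero => exact Ideal.zero_mem _
  | add a b _ _ ha hb => exact Ideal.add_mem _ ha hb
  | smul c a _ ha => exact lowIdeal_smul_mem h₁ h₂ h₃ c ha

/-- Degrees add under products of linear spans, while a left ideal has no such control over
multiplication on the right. The iterated commutators with `f 1` need both sides, hence the detour
through `lowSpan`. -/
theorem lowSpan_mul {M N : ℕ} {x y : Yangian h₁ h₂ h₃} (hx : x ∈ lowSpan h₁ h₂ h₃ M)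
    (hy : y ∈ lowSpan h₁ h₂ h₃ N) : x * y ∈ lowSpan h₁ h₂ h₃ (M + N) := by
  have h := Submodule.mul_mem_mul hx hy
  rw [lowSpan, lowSpan, Submodule.span_mul_span] at h
  refine Submodule.span_mono ?_ h
  rintro _ ⟨_, ⟨w, hw, rfl⟩, _, ⟨w', hw', rfl⟩, rfl⟩
  refine ⟨w ++ w', ?_, by simp⟩
  rw [List.map_append, List.sum_append]
  push_cast
  omega

theorem f_mem_lowSpan (j : ℕ) : toYangian h₁ h₂ h₃ (ff j) ∈ lowSpan h₁ h₂ h₃ 1 :=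
  Submodule.subset_span ⟨[Gen.f j], by simp [Gen.deg], by simp [ff]⟩

theorem adPow_f_mem_lowSpan (k : ℕ) :
    adPow (toYangian h₁ h₂ h₃ (ff 1)) k (toYangian h₁ h₂ h₃ (ff 0)) ∈
      lowSpan h₁ h₂ h₃ (k + 1) := by
  induction k with
  | zero => exact f_mem_lowSpan h₁ h₂ h₃ 0
  | succ k ih =>
    rw [adPow_succ, Ring.lie_def]
    refine Submodule.sub_mem _ ?_ (lowSpan_mul _ _ _ ih (f_mem_lowSpan _ _ _ 1))
    rw [add_comm (k + 1)]
    exact lowSpan_mul _ _ _ (f_mem_lowSpan _ _ _ 1) ih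

/-- The modes `a_{i,1}` in the Yangian itself. -/
def yangianBoson (z : Yangian h₁ h₂ h₃) : ℤ → Yangian h₁ h₂ h₃ :=
  bosonOne (fun j => toYangian h₁ h₂ h₃ (fe j)) (fun j => toYangian h₁ h₂ h₃ (ff j)) z

theorem yangianBoson_mem_lowIdeal (z : Yangian h₁ h₂ h₃) {i : ℤ} {N : ℕ} (hi : 0 < i)
    (hN : (N : ℤ) ≤ i) : yangianBoson h₁ h₂ h₃ z i ∈ lowIdeal h₁ h₂ h₃ N := by
  obtain ⟨k, rfl⟩ : ∃ k : ℕ, i = Int.ofNat (k + 1) := ⟨(i - 1).toNat, by simp; omega⟩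
  refine lowIdeal_anti _ _ _ (show N ≤ k + 1 by simp at hN; omega) (Ideal.neg_mem_iff _ |>.2 ?_)
  exact lowIdeal_smul_mem _ _ _ _ (lowSpan_subset _ _ _ (adPow_f_mem_lowSpan _ _ _ k))

/-- Outside the interval one of the two indices exceeds `N`, and normal ordering places that mode on
the right, where it forces the product into the left ideal. -/
theorem normalOrdered_mem_lowIdeal (z : Yangian h₁ h₂ h₃) (n N : ℕ) {i : ℤ}
    (hi : i ∉ Set.Icc (-(n : ℤ) - N) N) :
    normalOrdered (yangianBoson h₁ h₂ h₃ z) i (-(n : ℤ) - i) ∈ lowIdeal h₁ h₂ h₃ N := by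
  rw [Set.mem_Icc, not_and_or, not_le, not_le] at hi
  rcases hi with hi | hi
  · rw [normalOrdered, if_neg (by omega)]
    exact Ideal.mul_mem_left _ _ (yangianBoson_mem_lowIdeal _ _ _ z (by omega) (by omega))
  · rw [normalOrdered, if_pos (by omega)]
    exact Ideal.mul_mem_left _ _ (yangianBoson_mem_lowIdeal _ _ _ z (by omega) (by omega))

instance : NonarchimedeanRing (Yangian h₁ h₂ h₃) := (lowIdeal_basis h₁ h₂ h₃).nonarchimedean

theorem tendsto_cofinite_normalOrdered (z : Yangian h₁ h₂ h₃) (n : ℕ) (c : ℤ → ℂ) :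
    Filter.Tendsto (fun i : ℤ => c i • normalOrdered (yangianBoson h₁ h₂ h₃ z) i (-(n : ℤ) - i))
      Filter.cofinite (nhds 0) := by
  rw [(lowIdeal_basis h₁ h₂ h₃).hasBasis_nhds_zero.tendsto_right_iff]
  intro N _
  refine (Set.finite_Icc (-(n : ℤ) - N) N).subset fun i hi => ?_
  by_contra h
  exact hi (lowIdeal_smul_mem _ _ _ _ (normalOrdered_mem_lowIdeal _ _ _ z n N h))

/-- The canonical map from the Yangian to its completion. -/
def toCompleted : Yangian h₁ h₂ h₃ →ₐ[ℂ] CompletedYangian h₁ h₂ h₃ where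
  __ := (Completion.coeRingHom : Yangian h₁ h₂ h₃ →+* _)
  commutes' _ := rfl

theorem continuous_toCompleted : Continuous (toCompleted h₁ h₂ h₃) :=
  Completion.continuous_coe _

theorem toCompleted_psi (j : ℕ) :
    toCompleted h₁ h₂ h₃ (toYangian h₁ h₂ h₃ (fpsi j)) = CompletedYangian.psi h₁ h₂ h₃ j := rfl

theorem toCompleted_yangianBoson (z : Yangian h₁ h₂ h₃) (i : ℤ) :
    toCompleted h₁ h₂ h₃ (yangianBoson h₁ h₂ h₃ z i) = bosonOne (CompletedYangian.e h₁ h₂ h₃)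
      (CompletedYangian.f h₁ h₂ h₃) (toCompleted h₁ h₂ h₃ z) i :=
  map_bosonOne _ _ _ _ _

/-- In a complete nonarchimedean group, terms tending to $0$ are summable. Arbitrary coefficients
cost nothing, the ideals being stable under scalars, and `tsum_shift_sub` needs coefficients that
grow with $i$. -/
theorem summable_smul_normalOrdered (z : Yangian h₁ h₂ h₃) (n : ℕ) (c : ℤ → ℂ) :
    Summable fun i : ℤ => c i • normalOrdered (bosonOne (CompletedYangian.e h₁ h₂ h₃)
      (CompletedYangian.f h₁ h₂ h₃) (toCompleted h₁ h₂ h₃ z)) i (-(n : ℤ) - i) := by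
  apply NonarchimedeanAddGroup.summable_of_tendsto_cofinite_zero
  have h := ((continuous_toCompleted h₁ h₂ h₃).tendsto 0).comp
    (tendsto_cofinite_normalOrdered h₁ h₂ h₃ z n c)
  rw [map_zero] at h
  refine h.congr fun i => ?_
  rw [Function.comp_apply, map_smul, map_normalOrdered]
  congr 2
  exact funext (toCompleted_yangianBoson h₁ h₂ h₃ z)

theorem summable_normalOrdered (z : Yangian h₁ h₂ h₃) (n : ℕ) :
    Summable fun i : ℤ => normalOrdered (bosonOne (CompletedYangian.e h₁ h₂ h₃)
      (CompletedYangian.f h₁ h₂ h₃) (toCompleted h₁ h₂ h₃ z)) i (-(n : ℤ) - i) := by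
  simpa using summable_smul_normalOrdered h₁ h₂ h₃ z n 1

theorem toYangian_eq_of_rel {x y : Free} (h : Rel h₁ h₂ h₃ x y) :
    toYangian h₁ h₂ h₃ x = toYangian h₁ h₂ h₃ y :=
  RingQuot.mkAlgHom_rel ℂ h

theorem yangian_modeRelations :
    ModeRelations (fun j => toYangian h₁ h₂ h₃ (fe j)) (fun j => toYangian h₁ h₂ h₃ (ff j))
      (toYangian h₁ h₂ h₃ (fpsi 1)) (toYangian h₁ h₂ h₃ (fpsi 2)) where
  e_f_zero := by
    rw [← map_bracket]; exact toYangian_eq_of_rel _ _ _ (Rel.e_f 1 0)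
  e_f_one := by
    rw [← map_bracket]; exact toYangian_eq_of_rel _ _ _ (Rel.e_f 1 1)
  h_f_zero := by
    rw [← map_bracket, toYangian_eq_of_rel _ _ _ (Rel.psi_two_f 0), neg_mul, two_mul,
      map_neg, map_add, neg_smul, two_smul]
  h_f_one := by
    rw [← map_bracket, toYangian_eq_of_rel _ _ _ (Rel.psi_two_f 1), neg_mul, two_mul,
      map_neg, map_add, neg_smul, two_smul]
  e_z := by
    have h := toYangian_eq_of_rel _ _ _ (Rel.psi_one_e (h₁ := h₁) (h₂ := h₂) (h₃ := h₃) 1)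
    rw [map_bracket, map_zero, Ring.lie_def] at h
    rw [Ring.lie_def, ← neg_sub, h, neg_zero]
  f_z := by
    have h := toYangian_eq_of_rel _ _ _ (Rel.psi_one_f (h₁ := h₁) (h₂ := h₂) (h₃ := h₃) 1)
    rw [map_bracket, map_zero, Ring.lie_def] at h
    rw [Ring.lie_def, ← neg_sub, h, neg_zero]

theorem ModeRelations.map {A B : Type*} [Ring A] [Algebra ℂ A] [Ring B] [Algebra ℂ B]
    {e f : ℕ → A} {z h : A} (H : ModeRelations e f z h) (φ : A →ₐ[ℂ] B) :
    ModeRelations (φ ∘ e) (φ ∘ f) (φ z) (φ h) where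
  e_f_zero := by simp only [Function.comp_apply, ← map_bracket, H.e_f_zero]
  e_f_one := by simp only [Function.comp_apply, ← map_bracket, H.e_f_one]
  h_f_zero := by simp only [Function.comp_apply, ← map_bracket, H.h_f_zero, map_smul]
  h_f_one := by simp only [Function.comp_apply, ← map_bracket, H.h_f_one, map_smul]
  e_z := by simp only [Function.comp_apply, ← map_bracket, H.e_z, map_zero]
  f_z := by simp only [Function.comp_apply, ← map_bracket, H.f_z, map_zero]

theorem completed_modeRelations :
    ModeRelations (CompletedYangian.e h₁ h₂ h₃) (CompletedYangian.f h₁ h₂ h₃)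
      (CompletedYangian.psi h₁ h₂ h₃ 1) (CompletedYangian.psi h₁ h₂ h₃ 2) :=
  (yangian_modeRelations h₁ h₂ h₃).map (toCompleted h₁ h₂ h₃)

theorem bracket_tsum {A : Type*} [Ring A] [TopologicalSpace A] [IsTopologicalRing A] [T2Space A]
    (x : A) {F : ℤ → A} (hF : Summable F) : ⁅x, ∑' i, F i⁆ = ∑' i, ⁅x, F i⁆ := by
  simp only [Ring.lie_def]
  rw [(hF.mul_left x).tsum_sub (hF.mul_right x), hF.tsum_mul_left, hF.tsum_mul_right]

theorem bracket_spinTwo (k : ℕ) :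
    ⁅CompletedYangian.e h₁ h₂ h₃ 1, spinTwo h₁ h₂ h₃ (CompletedYangian.psi h₁ h₂ h₃ 1) (k + 2)⁆ =
      ((k : ℂ) + 1) • spinTwo h₁ h₂ h₃ (CompletedYangian.psi h₁ h₂ h₃ 1) (k + 1 + 2) := by
  have H := completed_modeRelations h₁ h₂ h₃
  have hs := summable_smul_normalOrdered h₁ h₂ h₃ (toYangian h₁ h₂ h₃ (fpsi 1)) (k + 1 + 2)
  have hs' := summable_normalOrdered h₁ h₂ h₃ (toYangian h₁ h₂ h₃ (fpsi 1)) (k + 2)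
  rw [toCompleted_psi] at hs'
  simp only [toCompleted_psi] at hs
  have ht := tsum_shift_sub hs ((k : ℂ) + 2)
  rw [spinTwo, spinTwo, bracket_sub, bracket_tsum _ hs', lie_linearPart, smul_sub]
  congr 1
  rw [show (k : ℂ) + 1 = (k : ℂ) + 2 - 1 by ring]
  refine Eq.trans (tsum_congr fun i => ?_) ht
  refine (H.lie_normalOrdered (by push_cast; omega)).trans ?_
  congr 2
  · congr 1
    push_cast; ring
  · push_cast; ring
  · congr 1
    push_cast; ring

theorem spinTwo_eq_adPow {n : ℕ} (hn : 2 ≤ n) :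
    spinTwo h₁ h₂ h₃ (CompletedYangian.psi h₁ h₂ h₃ 1) n =
      ((n - 2).factorial : ℂ)⁻¹ • adPow (CompletedYangian.e h₁ h₂ h₃ 1) (n - 2)
        (spinTwo h₁ h₂ h₃ (CompletedYangian.psi h₁ h₂ h₃ 1) 2) := by
  obtain ⟨k, rfl⟩ := Nat.exists_eq_add_of_le' hn
  exact eq_inv_factorial_smul_adPow (bracket_spinTwo h₁ h₂ h₃) k

theorem adPow_mul_of_commute {A : Type*} [Ring A] {x y : A} (h : ⁅x, y⁆ = 0) (n : ℕ) (w : A) :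
    adPow x n (y * w) = y * adPow x n w := by
  induction n with
  | zero => rfl
  | succ n ih => rw [adPow_succ, adPow_succ, ih, bracket_mul, h, zero_mul, zero_add]

theorem commute_psi_one_e (j : ℕ) :
    ⁅CompletedYangian.e h₁ h₂ h₃ j, CompletedYangian.psi h₁ h₂ h₃ 1⁆ = 0 := by
  have h := congrArg (toCompleted h₁ h₂ h₃) (toYangian_eq_of_rel _ _ _
    (Rel.psi_one_e (h₁ := h₁) (h₂ := h₂) (h₃ := h₃) j))
  rw [map_bracket, map_zero, map_zero, map_bracket, Ring.lie_def] at h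
  rw [Ring.lie_def, ← neg_sub, neg_eq_zero]
  exact h

theorem bosonOne_neg_natCast {A : Type*} [Ring A] [Algebra ℂ A] (e f : ℕ → A) (z : A) (k : ℕ) :
    bosonOne e f z (-((k + 1 : ℕ) : ℤ)) = (k.factorial : ℂ)⁻¹ • adPow (e 1) k (e 0) := rfl

theorem psi_one_mul_bosonOne_neg (z : CompletedYangian h₁ h₂ h₃) (k : ℕ) :
    bosonOne (CompletedYangian.e h₁ h₂ h₃) (CompletedYangian.f h₁ h₂ h₃) z (-((k + 1 : ℕ) : ℤ)) *
        CompletedYangian.psi h₁ h₂ h₃ 1 =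
      CompletedYangian.psi h₁ h₂ h₃ 1 * bosonOne (CompletedYangian.e h₁ h₂ h₃)
        (CompletedYangian.f h₁ h₂ h₃) z (-((k + 1 : ℕ) : ℤ)) := by
  rw [bosonOne_neg_natCast, smul_mul_assoc, mul_smul_comm]
  congr 1
  induction k with
  | zero => exact sub_eq_zero.1 (commute_psi_one_e h₁ h₂ h₃ 0)
  | succ k ih =>
    have h := sub_eq_zero.1 (commute_psi_one_e h₁ h₂ h₃ 1)
    rw [adPow_succ, Ring.lie_def, sub_mul, mul_sub, mul_assoc, ih, ← mul_assoc, h, mul_assoc,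
      mul_assoc _ _ (CompletedYangian.psi h₁ h₂ h₃ 1), h, ← mul_assoc _ (CompletedYangian.psi _ _ _ _),
      ih, mul_assoc]

/-- The two sums differ only at the indices $0$ and $-(k+1)$, and each of these terms equals
$\psi_1a_{-(k+1),1}$. The argument `0` of `bosonOne` on the right is immaterial at a negative index.
-/
theorem spinTwo_zero (k : ℕ) :
    spinTwo h₁ h₂ h₃ 0 (k + 1) = spinTwo h₁ h₂ h₃ (CompletedYangian.psi h₁ h₂ h₃ 1) (k + 1) +
      (2 : ℂ) • (CompletedYangian.psi h₁ h₂ h₃ 1 *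
        bosonOne (CompletedYangian.e h₁ h₂ h₃) (CompletedYangian.f h₁ h₂ h₃) 0
          (-((k + 1 : ℕ) : ℤ))) := by
  have hs := summable_normalOrdered h₁ h₂ h₃ (toYangian h₁ h₂ h₃ (fpsi 1)) (k + 1)
  have hs' := summable_normalOrdered h₁ h₂ h₃ 0 (k + 1)
  rw [toCompleted_psi] at hs
  rw [map_zero] at hs'
  have key := hs.tsum_sub hs'
  rw [tsum_eq_sum (s := {0, -((k + 1 : ℕ) : ℤ)}), Finset.sum_pair (by omega)] at key
  · have hz (z : CompletedYangian h₁ h₂ h₃) : bosonOne (CompletedYangian.e h₁ h₂ h₃)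
        (CompletedYangian.f h₁ h₂ h₃) z 0 = z := rfl
    have hb (z : CompletedYangian h₁ h₂ h₃) : bosonOne (CompletedYangian.e h₁ h₂ h₃)
        (CompletedYangian.f h₁ h₂ h₃) z (-((k + 1 : ℕ) : ℤ)) =
        bosonOne (CompletedYangian.e h₁ h₂ h₃)
        (CompletedYangian.f h₁ h₂ h₃) 0 (-((k + 1 : ℕ) : ℤ)) := rfl
    have hpos : (0 : ℤ) ≤ 0 ∧ -((k + 1 : ℕ) : ℤ) < 0 := by omega
    have hneg : ¬ (0 ≤ -((k + 1 : ℕ) : ℤ) ∧ (0 : ℤ) < 0) := by omega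
    simp only [normalOrdered, sub_self, sub_zero, if_pos hpos, if_neg hneg, hz, mul_zero,
      hb (CompletedYangian.psi h₁ h₂ h₃ 1), psi_one_mul_bosonOne_neg] at key
    rw [spinTwo, spinTwo, two_smul, key]
    simp only [normalOrdered]
    abel
  · intro i hi
    rw [Finset.mem_insert, Finset.mem_singleton, not_or] at hi
    have hne (z : CompletedYangian h₁ h₂ h₃) {m : ℤ} (hm : m ≠ 0) :
        bosonOne (CompletedYangian.e h₁ h₂ h₃) (CompletedYangian.f h₁ h₂ h₃) z m =
        bosonOne (CompletedYangian.e h₁ h₂ h₃) (CompletedYangian.f h₁ h₂ h₃) 0 m := by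
      rcases m with (_ | m) | m
      · exact absurd rfl hm
      · rfl
      · rfl
    simp only [normalOrdered, hne (CompletedYangian.psi h₁ h₂ h₃ 1) hi.1,
      hne (CompletedYangian.psi h₁ h₂ h₃ 1) (m := -((k + 1 : ℕ) : ℤ) - i) (by omega), sub_self]

/-- The correction from `spinTwo_zero` at $n$ is $2\psi_1a_{-n,1}$. Applying
$\mathrm{ad}_{e_1}^{n-2}/(n-2)!$ to the correction at $2$ gives $2(n-1)\psi_1a_{-n,1}$ instead,
because the factorials in $a_{-n,1}$ are $(n-1)!$. The difference is $-2(n-2)\psi_1a_{-n,1}$. -/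
theorem spinTwo_zero_eq_adPow {n : ℕ} (hn : 2 ≤ n) :
    spinTwo h₁ h₂ h₃ 0 n =
      ((n - 2).factorial : ℂ)⁻¹ • adPow (CompletedYangian.e h₁ h₂ h₃ 1) (n - 2)
          (spinTwo h₁ h₂ h₃ 0 2) -
        (2 * ((n : ℂ) - 2)) • (CompletedYangian.psi h₁ h₂ h₃ 1 *
          bosonOne (CompletedYangian.e h₁ h₂ h₃) (CompletedYangian.f h₁ h₂ h₃) 0 (-(n : ℤ))) := by
  have main := spinTwo_eq_adPow h₁ h₂ h₃ hn
  obtain ⟨k, rfl⟩ := Nat.exists_eq_add_of_le' hn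
  have hadd (y w : CompletedYangian h₁ h₂ h₃) (k : ℕ) :
      adPow (CompletedYangian.e h₁ h₂ h₃ 1) k (y + w) =
        adPow (CompletedYangian.e h₁ h₂ h₃ 1) k y + adPow (CompletedYangian.e h₁ h₂ h₃ 1) k w := by
    induction k with
    | zero => rfl
    | succ k ih => rw [adPow_succ, ih, adPow_succ, adPow_succ, Ring.lie_def, Ring.lie_def,
        Ring.lie_def]; noncomm_ring
  have hsmul (c : ℂ) (y : CompletedYangian h₁ h₂ h₃) (k : ℕ) :
      adPow (CompletedYangian.e h₁ h₂ h₃ 1) k (c • y) =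
        c • adPow (CompletedYangian.e h₁ h₂ h₃ 1) k y := by
    induction k with
    | zero => rfl
    | succ k ih => rw [adPow_succ, ih, adPow_succ, bracket_smul]
  have hcomp : adPow (CompletedYangian.e h₁ h₂ h₃ 1) k
      (adPow (CompletedYangian.e h₁ h₂ h₃ 1) 1 (CompletedYangian.e h₁ h₂ h₃ 0)) =
      adPow (CompletedYangian.e h₁ h₂ h₃ 1) (k + 1) (CompletedYangian.e h₁ h₂ h₃ 0) :=
    (Function.iterate_add_apply _ k 1 _).symm
  rw [Nat.add_sub_cancel] at main ⊢
  rw [spinTwo_zero h₁ h₂ h₃ 1, spinTwo_zero h₁ h₂ h₃ (k + 1), hadd, smul_add, ← main, hsmul,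
    adPow_mul_of_commute (commute_psi_one_e h₁ h₂ h₃ 1), bosonOne_neg_natCast,
    bosonOne_neg_natCast, hsmul, hcomp, add_sub_assoc]
  congr 1
  simp only [mul_smul_comm, smul_smul, ← sub_smul]
  congr 1
  have hf : (k.factorial : ℂ) ≠ 0 := Nat.cast_ne_zero.2 k.factorial_ne_zero
  have hk : ((k : ℂ) + 1) ≠ 0 := Nat.cast_add_one_ne_zero k
  simp only [Nat.factorial_succ, Nat.factorial_zero]
  push_cast
  field_simp
  ring

end

/-! ### Combinatorics of plane partitions along the diagonals parallel to $(1,1,1)$ -/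

section

namespace PlanePartition

variable (π : PlanePartition)

/-- Membership in the lower set in `ℤ³` that consists of `π` and of all points with a negative
coordinate. -/
def ExtMem (x y z : ℤ) : Prop :=
  x < 0 ∨ y < 0 ∨ z < 0 ∨ (x.toNat, y.toNat, z.toNat) ∈ π.cells

variable {π} in
theorem ExtMem.anti {x y z x' y' z' : ℤ} (h : π.ExtMem x y z) (hx : x' ≤ x) (hy : y' ≤ y)
    (hz : z' ≤ z) : π.ExtMem x' y' z' := by
  rcases h with h | h | h | h
  · exact Or.inl (by omega)
  · exact Or.inr (Or.inl (by omega))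
  · exact Or.inr (Or.inr (Or.inl (by omega)))
  · refine Or.inr (Or.inr (Or.inr (π.isLowerSet ?_ h)))
    simp only [Prod.mk_le_mk]
    omega

theorem extMem_natCast (x y z : ℕ) : π.ExtMem x y z ↔ (x, y, z) ∈ π.cells := by
  simp only [ExtMem, Int.toNat_natCast]
  have := Int.natCast_nonneg x
  have := Int.natCast_nonneg y
  have := Int.natCast_nonneg z
  grind

/-- A lower set is left once and for all when moving in the direction $(1,1,1)$, and finiteness of
`π` makes this happen. -/
theorem exists_height (p q : ℤ) : ∃ T : ℤ, ∀ z : ℤ, π.ExtMem (p + z) (q + z) z ↔ z < T := by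
  obtain ⟨N, hN⟩ : ∃ N : ℕ, ∀ b ∈ π.cells, b.2.2 < N := by
    refine ⟨π.cells.sup (fun b => b.2.2) + 1, fun b hb => Nat.lt_succ_of_le ?_⟩
    exact Finset.le_sup (f := fun b : Box => b.2.2) hb
  have hbd : ∀ z : ℤ, ¬π.ExtMem (p + z) (q + z) z → 0 ≤ z := fun z hz => by
    by_contra h
    exact hz (Or.inr (Or.inr (Or.inl (by omega))))
  have hex : ∃ z : ℤ, ¬π.ExtMem (p + z) (q + z) z := by
    -- Here all three coordinates are nonnegative and the point lies above every box.
    refine ⟨max (N : ℤ) (max (-p) (-q)), ?_⟩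
    rintro (h | h | h | h)
    · omega
    · omega
    · omega
    · have := hN _ h
      simp only at this
      omega
  obtain ⟨T, hT, hmin⟩ := Int.exists_least_of_bdd ⟨0, hbd⟩ hex
  refine ⟨T, fun z => ⟨fun h => ?_, fun h => ?_⟩⟩
  · by_contra hz
    exact hT (h.anti (by omega) (by omega) (by omega))
  · by_contra hz
    exact absurd (hmin z hz) (by omega)

/-- The least `z` such that `(p + z, q + z, z)` is not in the extension of `π`. -/
def height (p q : ℤ) : ℤ := (π.exists_height p q).choose

theorem extMem_iff_lt_height (p q z : ℤ) : π.ExtMem (p + z) (q + z) z ↔ z < π.height p q :=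
  (π.exists_height p q).choose_spec z

theorem extMem_iff {x y z : ℤ} (p q : ℤ) (hx : x - z = p) (hy : y - z = q) :
    π.ExtMem x y z ↔ z < π.height p q := by
  rw [← extMem_iff_lt_height, ← hx, ← hy, sub_add_cancel, sub_add_cancel]

/-- `b` lies on the diagonal `x - z = p`, `y - z = q`. -/
def OnDiag (b : Box) (p q : ℤ) : Prop := (b.1 : ℤ) - b.2.2 = p ∧ (b.2.1 : ℤ) - b.2.2 = q

instance (b : Box) (p q : ℤ) : Decidable (OnDiag b p q) := inferInstanceAs (Decidable (_ ∧ _))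

/-- The number of boxes of `π` on a diagonal. -/
def diagCount (p q : ℤ) : ℕ := (π.cells.filter fun b => OnDiag b p q).card

/-- The diagonal enters the octant at $z=\max(0,-p,-q)$, and its boxes fill the range from there up
to the height. -/
theorem diagCount_eq (p q : ℤ) :
    (π.diagCount p q : ℤ) = π.height p q - max 0 (max (-p) (-q)) := by
  have hle : max 0 (max (-p) (-q)) ≤ π.height p q := by
    by_contra h
    have h1 : π.ExtMem (p + π.height p q) (q + π.height p q) (π.height p q) := by
      unfold ExtMem
      omega
    exact lt_irrefl _ ((π.extMem_iff_lt_height p q _).1 h1)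
  have hcard : π.diagCount p q = (Finset.Ico (max 0 (max (-p) (-q))) (π.height p q)).card := by
    refine Finset.card_nbij' (fun b => (b.2.2 : ℤ))
      (fun z => ((p + z).toNat, (q + z).toNat, z.toNat)) ?_ ?_ ?_ ?_
    · rintro ⟨x, y, z⟩ hb
      rw [Finset.mem_coe, Finset.mem_filter] at hb
      simp only [OnDiag] at hb
      obtain ⟨hb, hx, hy⟩ := hb
      rw [← extMem_natCast, π.extMem_iff p q hx hy] at hb
      simp only [Finset.coe_Ico, Set.mem_Ico]
      omega
    · intro z hz
      simp only [Finset.coe_Ico, Set.mem_Ico] at hz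
      have h := (π.extMem_iff_lt_height p q z).2 hz.2
      rw [Finset.mem_coe, Finset.mem_filter]
      simp only [OnDiag]
      refine ⟨?_, by omega, by omega⟩
      unfold ExtMem at h
      rcases h with h | h | h | h
      · omega
      · omega
      · omega
      · exact h
    · rintro ⟨x, y, z⟩ hb
      rw [Finset.mem_coe, Finset.mem_filter] at hb
      simp only [OnDiag] at hb
      simp only [Prod.mk.injEq]
      omega
    · intro z hz
      simp only [Finset.coe_Ico, Set.mem_Ico] at hz
      simp only
      omega
  rw [hcard, Int.card_Ico, Int.toNat_of_nonneg (by omega)]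

/-- Because the extension is a lower set, a unit step to a neighbouring diagonal can lower the
height by at most $1$ and cannot raise it. The next two lemmas are the same for the other
directions. -/
theorem height_succ_left (p q : ℤ) :
    π.height (p + 1) q ≤ π.height p q ∧ π.height p q - 1 ≤ π.height (p + 1) q := by
  constructor
  · by_contra h
    have h1 := (π.extMem_iff_lt_height (p + 1) q (π.height p q)).2 (by omega)
    exact lt_irrefl _ ((π.extMem_iff_lt_height p q _).1 (h1.anti (by omega) le_rfl le_rfl))
  · by_contra h
    have h1 := (π.extMem_iff_lt_height p q (π.height (p + 1) q + 1)).2 (by omega)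
    exact lt_irrefl _ ((π.extMem_iff_lt_height (p + 1) q _).1
      (h1.anti (by omega) (by omega) (by omega)))

theorem height_succ_right (p q : ℤ) :
    π.height p (q + 1) ≤ π.height p q ∧ π.height p q - 1 ≤ π.height p (q + 1) := by
  constructor
  · by_contra h
    have h1 := (π.extMem_iff_lt_height p (q + 1) (π.height p q)).2 (by omega)
    exact lt_irrefl _ ((π.extMem_iff_lt_height p q _).1 (h1.anti le_rfl (by omega) le_rfl))
  · by_contra h
    have h1 := (π.extMem_iff_lt_height p q (π.height p (q + 1) + 1)).2 (by omega)
    exact lt_irrefl _ ((π.extMem_iff_lt_height p (q + 1) _).1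
      (h1.anti (by omega) (by omega) (by omega)))

theorem height_succ_succ (p q : ℤ) :
    π.height (p + 1) (q + 1) ≤ π.height p q ∧ π.height p q - 1 ≤ π.height (p + 1) (q + 1) := by
  have h1 := π.height_succ_left p q
  have h2 := π.height_succ_right (p + 1) q
  refine ⟨by omega, ?_⟩
  by_contra h
  have h1 := (π.extMem_iff_lt_height p q (π.height (p + 1) (q + 1) + 1)).2 (by omega)
  exact lt_irrefl _ ((π.extMem_iff_lt_height (p + 1) (q + 1) _).1
    (h1.anti (by omega) (by omega) (by omega)))

theorem mem_of_lt_insert {b c : Box} (hb : IsLowerSet ((insert b π.cells : Finset Box) : Set Box))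
    (hc : c ≤ b) (hne : c ≠ b) : c ∈ π.cells := by
  simpa [hne] using hb hc (by simp)

theorem addable_of_pred {x y z : ℕ} (h : (x, y, z) ∉ π.cells) (hx : π.ExtMem (x - 1) y z)
    (hy : π.ExtMem x (y - 1) z) (hz : π.ExtMem x y (z - 1)) : π.Addable (x, y, z) := by
  refine ⟨h, ?_⟩
  rintro a ⟨x', y', z'⟩ hc ha
  simp only [Finset.coe_insert, Set.mem_insert_iff, Finset.mem_coe] at ha ⊢
  rcases ha with rfl | ha
  · by_cases hne : (x', y', z') = (x, y, z)
    · exact Or.inl hne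
    · right
      simp only [Prod.mk_le_mk] at hc
      simp only [Prod.mk.injEq] at hne
      rw [← extMem_natCast]
      rcases (by omega : x' < x ∨ y' < y ∨ z' < z) with h' | h' | h'
      · exact hx.anti (by omega) (by omega) (by omega)
      · exact hy.anti (by omega) (by omega) (by omega)
      · exact hz.anti (by omega) (by omega) (by omega)
  · exact Or.inr (π.isLowerSet hc ha)

theorem removable_of_succ {x y z : ℕ} (h : (x, y, z) ∈ π.cells) (hx : ¬π.ExtMem (x + 1) y z)
    (hy : ¬π.ExtMem x (y + 1) z) (hz : ¬π.ExtMem x y (z + 1)) : π.Removable (x, y, z) := by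
  refine ⟨h, ?_⟩
  rintro ⟨x', y', z'⟩ a hc ha
  simp only [Finset.coe_erase, Set.mem_sdiff, Finset.mem_coe, Set.mem_singleton_iff] at ha ⊢
  refine ⟨π.isLowerSet hc ha.1, ?_⟩
  rintro rfl
  obtain ⟨ha, hne⟩ := ha
  simp only [Prod.mk_le_mk] at hc
  simp only [Prod.mk.injEq] at hne
  rw [← extMem_natCast] at ha
  rcases (by omega : x < x' ∨ y < y' ∨ z < z') with h' | h' | h'
  · exact hx (ha.anti (by omega) (by omega) (by omega))
  · exact hy (ha.anti (by omega) (by omega) (by omega))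
  · exact hz (ha.anti (by omega) (by omega) (by omega))

/-- `b` can be added to or removed from `π`. -/
def IsCorner (b : Box) : Prop := π.Addable b ∨ π.Removable b

/-- The candidate is the first point of the diagonal outside the extension. Its three predecessors
lie on neighbouring diagonals, and the hypotheses say that they are inside. Dually,
`exists_removable` takes the last point inside and its three successors. -/
theorem exists_addable {p q : ℤ} (h1 : π.height p q < π.height (p - 1) q)
    (h2 : π.height p q < π.height p (q - 1)) (h3 : π.height p q ≤ π.height (p + 1) (q + 1)) :
    ∃ b, OnDiag b p q ∧ π.Addable b := by
  set T := π.height p q with hT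
  have hno : ¬π.ExtMem (p + T) (q + T) T := fun h => lt_irrefl _ ((π.extMem_iff_lt_height p q T).1 h)
  have hpos : 0 ≤ p + T ∧ 0 ≤ q + T ∧ 0 ≤ T := by
    unfold ExtMem at hno
    omega
  obtain ⟨x, hx⟩ := Int.eq_ofNat_of_zero_le hpos.1
  obtain ⟨y, hy⟩ := Int.eq_ofNat_of_zero_le hpos.2.1
  obtain ⟨z, hz⟩ := Int.eq_ofNat_of_zero_le hpos.2.2
  refine ⟨(x, y, z), ⟨by simp only; omega, by simp only; omega⟩, π.addable_of_pred ?_ ?_ ?_ ?_⟩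
  · rwa [← extMem_natCast, ← hx, ← hy, ← hz]
  · rw [π.extMem_iff (p - 1) q (by omega) (by omega)]; omega
  · rw [π.extMem_iff p (q - 1) (by omega) (by omega)]; omega
  · rw [π.extMem_iff (p + 1) (q + 1) (by omega) (by omega)]; omega

theorem exists_removable {p q : ℤ} (h1 : π.height (p + 1) q < π.height p q)
    (h2 : π.height p (q + 1) < π.height p q) (h3 : π.height (p - 1) (q - 1) ≤ π.height p q) :
    ∃ b, OnDiag b p q ∧ π.Removable b := by
  set T := π.height p q with hT
  have hx' : ¬π.ExtMem (p + (T - 1) + 1) (q + (T - 1)) (T - 1) := by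
    rw [π.extMem_iff (p + 1) q (by omega) (by omega)]; omega
  have hy' : ¬π.ExtMem (p + (T - 1)) (q + (T - 1) + 1) (T - 1) := by
    rw [π.extMem_iff p (q + 1) (by omega) (by omega)]; omega
  have hz' : ¬π.ExtMem (p + (T - 1)) (q + (T - 1)) (T - 1 + 1) := by
    rw [π.extMem_iff (p - 1) (q - 1) (by omega) (by omega)]; omega
  have hpos : 0 ≤ p + (T - 1) ∧ 0 ≤ q + (T - 1) ∧ 0 ≤ T - 1 := by
    unfold ExtMem at hx' hy' hz'
    omega
  obtain ⟨x, hx⟩ := Int.eq_ofNat_of_zero_le hpos.1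
  obtain ⟨y, hy⟩ := Int.eq_ofNat_of_zero_le hpos.2.1
  obtain ⟨z, hz⟩ := Int.eq_ofNat_of_zero_le hpos.2.2
  rw [hx, hy, hz] at hx' hy' hz'
  refine ⟨(x, y, z), ⟨by simp only; omega, by simp only; omega⟩,
    π.removable_of_succ ?_ hx' hy' hz'⟩
  rw [← extMem_natCast, π.extMem_iff p q (by omega) (by omega)]; omega

theorem addable_height {b : Box} {p q : ℤ} (hb : OnDiag b p q) (h : π.Addable b) :
    (b.2.2 : ℤ) = π.height p q := by
  obtain ⟨x, y, z⟩ := b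
  have h1 : ¬ (z : ℤ) < π.height p q := by
    rw [← π.extMem_iff p q hb.1 hb.2, extMem_natCast]
    exact h.1
  have h2 : (z : ℤ) - 1 < π.height p q := by
    have hb1 := hb.1
    have hb2 := hb.2
    simp only at hb1 hb2
    rw [← π.extMem_iff (x := x - 1) (y := y - 1) p q (by omega) (by omega)]
    unfold ExtMem
    by_cases hneg : (x : ℤ) - 1 < 0 ∨ (y : ℤ) - 1 < 0 ∨ (z : ℤ) - 1 < 0
    · tauto
    · refine Or.inr (Or.inr (Or.inr (π.mem_of_lt_insert h.2 ?_ ?_)))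
      · simp only [Prod.mk_le_mk]; omega
      · simp only [ne_eq, Prod.mk.injEq]; omega
  simp only
  omega

theorem not_mem_of_removable_lt {b c : Box} (hb : π.Removable b) (hc : b < c) : c ∉ π.cells := by
  intro h
  have h' : c ∈ ((π.cells.erase b : Finset Box) : Set Box) := by simp [h, hc.ne']
  simpa using hb.2 hc.le h'

theorem removable_height {b : Box} {p q : ℤ} (hb : OnDiag b p q) (h : π.Removable b) :
    (b.2.2 : ℤ) + 1 = π.height p q := by
  obtain ⟨x, y, z⟩ := b
  have h1 : (z : ℤ) < π.height p q := by
    rw [← π.extMem_iff p q hb.1 hb.2, extMem_natCast]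
    exact h.1
  have h2 : ¬ ((z + 1 : ℕ) : ℤ) < π.height p q := by
    have hb1 := hb.1
    have hb2 := hb.2
    simp only at hb1 hb2
    rw [← π.extMem_iff (x := (x + 1 : ℕ)) (y := (y + 1 : ℕ)) p q (by omega) (by omega),
      extMem_natCast]
    refine π.not_mem_of_removable_lt h (lt_of_le_of_ne ?_ ?_)
    · simp only [Prod.mk_le_mk]; omega
    · simp
  simp only
  omega

theorem OnDiag.ext {b c : Box} {p q : ℤ} (hb : OnDiag b p q) (hc : OnDiag c p q)
    (h : b.2.2 = c.2.2) : b = c := by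
  obtain ⟨x, y, z⟩ := b
  obtain ⟨x', y', z'⟩ := c
  simp only [OnDiag] at hb hc h
  simp only [Prod.mk.injEq]
  omega

/-- The heights force $b=c+(1,1,1)$. Then $c+(1,0,0)$ belongs to `π` as a point below the addable
`b`, and does not as a point above the removable `c`. -/
theorem not_addable_removable_diag {b c : Box} {p q : ℤ} (hb : OnDiag b p q) (hc : OnDiag c p q)
    (h : π.Addable b) (h' : π.Removable c) : False := by
  have e1 := π.addable_height hb h
  have e2 := π.removable_height hc h'
  obtain ⟨x, y, z⟩ := b
  obtain ⟨x', y', z'⟩ := c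
  simp only [OnDiag] at hb hc e1 e2
  refine π.not_mem_of_removable_lt h' (c := (x' + 1, y', z')) (lt_of_le_of_ne ?_ ?_)
    (π.mem_of_lt_insert h.2 ?_ ?_)
  · simp
  · simp
  · simp only [Prod.mk_le_mk]; omega
  · simp only [ne_eq, Prod.mk.injEq]; omega

theorem IsCorner.eq_of_onDiag {π : PlanePartition} {b c : Box} {p q : ℤ} (hb : π.IsCorner b)
    (hc : π.IsCorner c) (hbd : OnDiag b p q) (hcd : OnDiag c p q) : b = c := by
  rcases hb with hb | hb <;> rcases hc with hc | hc
  · have e1 := π.addable_height hbd hb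
    have e2 := π.addable_height hcd hc
    exact hbd.ext hcd (by omega)
  · exact (π.not_addable_removable_diag hbd hcd hb hc).elim
  · exact (π.not_addable_removable_diag hcd hbd hc hb).elim
  · have e1 := π.removable_height hbd hb
    have e2 := π.removable_height hcd hc
    exact hbd.ext hcd (by omega)

open Classical in
/-- The function `ψ_π` has at most a simple pole at the weight of each diagonal, and none unless
there is an addable or a removable box on the diagonal. -/
theorem diagCount_le (p q : ℤ) :
    (if p = 0 ∧ q = 0 then 1 else 0) + (π.diagCount p (q - 1) + π.diagCount (p - 1) q +
        π.diagCount (p + 1) (q + 1)) ≤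
      π.diagCount p (q + 1) + π.diagCount (p + 1) q + π.diagCount (p - 1) (q - 1) +
        if ∃ b, OnDiag b p q ∧ π.IsCorner b then 1 else 0 := by
  have c1 := π.diagCount_eq p (q - 1)
  have c2 := π.diagCount_eq (p - 1) q
  have c3 := π.diagCount_eq (p + 1) (q + 1)
  have c4 := π.diagCount_eq p (q + 1)
  have c5 := π.diagCount_eq (p + 1) q
  have c6 := π.diagCount_eq (p - 1) (q - 1)
  -- This is the balance for the empty partition: the starting points of the diagonals account
  -- exactly for the pole of $1/u$ at $0$. What remains is an inequality between heights.
  have hm : max 0 (max (-p) (-(q - 1))) + max 0 (max (-(p - 1)) (-q)) +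
      max 0 (max (-(p + 1)) (-(q + 1))) = max 0 (max (-p) (-(q + 1))) +
      max 0 (max (-(p + 1)) (-q)) + max 0 (max (-(p - 1)) (-(q - 1))) +
      if p = 0 ∧ q = 0 then 1 else 0 := by
    split_ifs <;> omega
  -- The six neighbouring diagonals form a hexagon on which poles and zeros alternate. The bounds
  -- `r1` to `r6` compare the centre with the vertices, `r7` to `r12` the consecutive vertices.
  have r1 := π.height_succ_left p q
  have r2 := π.height_succ_left (p - 1) q
  have r3 := π.height_succ_right p q
  have r4 := π.height_succ_right p (q - 1)
  have r5 := π.height_succ_succ p q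
  have r6 := π.height_succ_succ (p - 1) (q - 1)
  have r7 := π.height_succ_succ (p - 1) q
  have r8 := π.height_succ_succ p (q - 1)
  have r9 := π.height_succ_left (p - 1) (q - 1)
  have r10 := π.height_succ_right (p - 1) (q - 1)
  have r11 := π.height_succ_left p (q + 1)
  have r12 := π.height_succ_right (p + 1) q
  simp only [sub_add_cancel] at r2 r4 r6 r7 r8 r9 r10
  have ha := π.exists_addable (p := p) (q := q)
  have hr := π.exists_removable (p := p) (q := q)
  zify
  rw [c1, c2, c3, c4, c5, c6]
  clear c1 c2 c3 c4 c5 c6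
  generalize max 0 (max (-p) (-(q - 1))) = m1 at *
  generalize max 0 (max (-(p - 1)) (-q)) = m2 at *
  generalize max 0 (max (-(p + 1)) (-(q + 1))) = m3 at *
  generalize max 0 (max (-p) (-(q + 1))) = m4 at *
  generalize max 0 (max (-(p + 1)) (-q)) = m5 at *
  generalize max 0 (max (-(p - 1)) (-(q - 1))) = m6 at *
  generalize (if p = 0 ∧ q = 0 then (1 : ℤ) else 0) = δ at *
  by_cases hc : ∃ b, OnDiag b p q ∧ π.IsCorner b
  · rw [if_pos hc]
    omega
  · rw [if_neg hc]
    have ha' : ¬ ∃ b, OnDiag b p q ∧ π.Addable b := fun ⟨b, h, h'⟩ => hc ⟨b, h, Or.inl h'⟩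
    have hr' : ¬ ∃ b, OnDiag b p q ∧ π.Removable b := fun ⟨b, h, h'⟩ => hc ⟨b, h, Or.inr h'⟩
    have ha2 : ¬(π.height p q < π.height (p - 1) q ∧ π.height p q < π.height p (q - 1) ∧
        π.height p q ≤ π.height (p + 1) (q + 1)) := fun h => ha' (ha h.1 h.2.1 h.2.2)
    have hr2 : ¬(π.height (p + 1) q < π.height p q ∧ π.height p (q + 1) < π.height p q ∧
        π.height (p - 1) (q - 1) ≤ π.height p q) := fun h => hr' (hr h.1 h.2.1 h.2.2)
    clear ha hr ha' hr' hc
    by_cases h1 : π.height p q < π.height (p - 1) q <;>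
    by_cases h2 : π.height p q < π.height p (q - 1) <;>
    by_cases h3 : π.height p q ≤ π.height (p + 1) (q + 1) <;>
    omega

end PlanePartition

end

/-! ### Partial fractions and Laurent expansions -/

section

/-- Partial fractions for a quotient of two monic polynomials of the same degree, the denominator
having simple roots. -/
theorem exists_partialFractions (S : Finset ℂ) (R : Multiset ℂ) (hR : R.card = S.card) :
    ∃ r : ℂ → ℂ, ∀ {K : Type} [Field K] (φ : ℂ →+* K) (u : K), (∀ a, u - φ a ≠ 0) →
      (R.map fun a => u - φ a).prod / ∏ a ∈ S, (u - φ a) = 1 + ∑ a ∈ S, φ (r a) / (u - φ a) := by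
  classical
  induction S using Finset.induction_on generalizing R with
  | empty =>
    rw [Finset.card_empty, Multiset.card_eq_zero] at hR
    exact ⟨0, fun φ u _ => by simp [hR]⟩
  | insert w S hw ih =>
    rw [Finset.card_insert_of_notMem hw] at hR
    obtain ⟨a, ha⟩ := Multiset.card_pos_iff_exists_mem.1 (by omega : 0 < R.card)
    obtain ⟨R, rfl⟩ := Multiset.exists_cons_of_mem ha
    rw [Multiset.card_cons, Nat.add_right_cancel_iff] at hR
    obtain ⟨r, hr⟩ := ih R hR
    -- The new factor is $(u-a)/(u-w)=1+(w-a)/(u-w)$. The residue at $w$ is $(w-a)$ times the old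
    -- function evaluated at $w$; each old residue is multiplied by the new factor evaluated at $v$.
    refine ⟨fun v => if v = w then (w - a) * (1 - ∑ v ∈ S, r v / (v - w))
      else r v * (1 + (w - a) / (v - w)), fun φ u hu => ?_⟩
    have hS : ∑ v ∈ S, φ (if v = w then (w - a) * (1 - ∑ v ∈ S, r v / (v - w))
          else r v * (1 + (w - a) / (v - w))) / (u - φ v) =
        ∑ v ∈ S, (φ (r v) / (u - φ v) * (1 + (φ w - φ a) / (u - φ w)) +
          (φ w - φ a) * (φ (r v) / (φ v - φ w)) / (u - φ w)) := by
      refine Finset.sum_congr rfl fun v hv => ?_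
      have hne : v ≠ w := fun h => hw (h ▸ hv)
      have hvw : φ v - φ w ≠ 0 := by
        rw [← map_sub, map_ne_zero, sub_ne_zero]
        exact hne
      rw [if_neg hne]
      simp only [map_mul, map_add, map_one, map_div₀, map_sub]
      have h1 := hu v
      have h2 := hu w
      field_simp
      ring
    beta_reduce
    rw [Multiset.map_cons, Multiset.prod_cons, Finset.prod_insert hw, Finset.sum_insert hw,
      if_pos rfl, hS, mul_div_mul_comm, hr φ u hu, Finset.sum_add_distrib, ← Finset.sum_mul, ← Finset.sum_div,
      ← Finset.mul_sum]
    simp only [map_mul, map_sub, map_one, map_sum, map_div₀]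
    have h2 := hu w
    field_simp
    ring

/-! ### Laurent series -/

theorem coeff_coe_neg_one (g : PowerSeries ℂ) : (g : LaurentSeries ℂ).coeff (-1) = 0 := by
  rw [PowerSeries.coeff_coe, if_pos (by norm_num)]

theorem coe_mul_coe_inv {g : PowerSeries ℂ} (hg : PowerSeries.constantCoeff g ≠ 0) :
    (g : LaurentSeries ℂ) * ((g⁻¹ : PowerSeries ℂ) : LaurentSeries ℂ) = 1 := by
  rw [← PowerSeries.coe_mul, PowerSeries.mul_inv_cancel _ hg, PowerSeries.coe_one]

theorem inv_coe {g : PowerSeries ℂ} (hg : PowerSeries.constantCoeff g ≠ 0) :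
    (g : LaurentSeries ℂ)⁻¹ = ((g⁻¹ : PowerSeries ℂ) : LaurentSeries ℂ) :=
  inv_eq_of_mul_eq_one_right (coe_mul_coe_inv hg)

theorem C_add_single_eq_coe (a : ℂ) :
    (HahnSeries.C a + HahnSeries.single 1 1 : LaurentSeries ℂ) =
      ((PowerSeries.C a + PowerSeries.X : PowerSeries ℂ) : LaurentSeries ℂ) := by
  rw [PowerSeries.coe_add, PowerSeries.coe_C, PowerSeries.coe_X]

theorem single_one_mul_single_neg_one :
    (HahnSeries.single (1 : ℤ) (1 : ℂ) * HahnSeries.single (-1 : ℤ) (1 : ℂ) : LaurentSeries ℂ) =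
      1 := by
  simp

theorem C_add_single_ne_C (a b : ℂ) :
    (HahnSeries.C a + HahnSeries.single 1 1 : LaurentSeries ℂ) - HahnSeries.C b ≠ 0 := by
  intro h
  have := congrArg (fun x : LaurentSeries ℂ => x.coeff 1) h
  simp [HahnSeries.C_apply] at this

theorem single_neg_one_ne_C (b : ℂ) :
    (HahnSeries.single (-1) 1 : LaurentSeries ℂ) - HahnSeries.C b ≠ 0 := by
  intro h
  have := congrArg (fun x : LaurentSeries ℂ => x.coeff (-1)) h
  simp [HahnSeries.C_apply] at this

theorem exists_coe_div (r a w : ℂ) (h : a ≠ w) : ∃ g : PowerSeries ℂ,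
    HahnSeries.C r / ((HahnSeries.C a + HahnSeries.single 1 1 : LaurentSeries ℂ) -
      HahnSeries.C w) = (g : LaurentSeries ℂ) := by
  refine ⟨PowerSeries.C r * (PowerSeries.C (a - w) + PowerSeries.X)⁻¹, ?_⟩
  rw [PowerSeries.coe_mul, ← inv_coe (by simpa [sub_eq_zero] using h), PowerSeries.coe_C,
    ← C_add_single_eq_coe, div_eq_mul_inv, map_sub]
  congr 2
  ring

theorem C_div_single (r a : ℂ) :
    HahnSeries.C r / ((HahnSeries.C a + HahnSeries.single 1 1 : LaurentSeries ℂ) -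
      HahnSeries.C a) = HahnSeries.single (-1) r := by
  rw [add_sub_cancel_left, div_eq_iff (by simp)]
  simp [HahnSeries.C_apply]

theorem exists_sum_C_div_eq_single_add (S : Finset ℂ) (r : ℂ → ℂ) (a : ℂ) :
    ∃ g : PowerSeries ℂ,
      ∑ w ∈ S, HahnSeries.C (r w) / ((HahnSeries.C a + HahnSeries.single 1 1 : LaurentSeries ℂ) -
        HahnSeries.C w) = HahnSeries.single (-1) (if a ∈ S then r a else 0) +
          (g : LaurentSeries ℂ) := by
  classical
  induction S using Finset.induction_on with
  | empty => exact ⟨0, by simp⟩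
  | insert w S hw ih =>
    obtain ⟨g, hg⟩ := ih
    rw [Finset.sum_insert hw, hg]
    rcases eq_or_ne a w with rfl | hne
    · exact ⟨g, by rw [C_div_single, if_neg hw, if_pos (Finset.mem_insert_self _ _)]; simp⟩
    · obtain ⟨g', hg'⟩ := exists_coe_div (r w) a w hne
      refine ⟨g + g', ?_⟩
      rw [hg', PowerSeries.coe_add]
      simp only [Finset.mem_insert, hne, false_or]
      ring

/-- The geometric series $r/(u-w)=\sum_j r\,w^ju^{-j-1}$ in $t=u^{-1}$. -/
theorem coeff_C_div_single_neg_one (r w : ℂ) (j : ℕ) :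
    (HahnSeries.C r / ((HahnSeries.single (-1) 1 : LaurentSeries ℂ) - HahnSeries.C w)).coeff
      ((j : ℤ) + 1) = r * w ^ j := by
  have hg : ((1 - PowerSeries.C w * PowerSeries.X : PowerSeries ℂ) *
      PowerSeries.mk fun n => w ^ n) = 1 := by
    ext n
    rw [sub_mul, one_mul, mul_assoc, map_sub, PowerSeries.coeff_C_mul]
    rcases n with _ | n
    · simp
    · rw [PowerSeries.coeff_succ_X_mul]
      simp [PowerSeries.coeff_one, pow_succ']
  have hg' := congrArg (fun x : PowerSeries ℂ => (x : LaurentSeries ℂ)) hg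
  simp only [PowerSeries.coe_mul, PowerSeries.coe_sub, PowerSeries.coe_one, PowerSeries.coe_C,
    PowerSeries.coe_X] at hg'
  have key : HahnSeries.C r / ((HahnSeries.single (-1) 1 : LaurentSeries ℂ) - HahnSeries.C w) =
      HahnSeries.single 1 1 * ((PowerSeries.C r * PowerSeries.mk fun n => w ^ n : PowerSeries ℂ) :
        LaurentSeries ℂ) := by
    rw [div_eq_iff (single_neg_one_ne_C w), PowerSeries.coe_mul, PowerSeries.coe_C]
    linear_combination (-HahnSeries.C r) * hg' -
      HahnSeries.C r * ((PowerSeries.mk fun n => w ^ n : PowerSeries ℂ) : LaurentSeries ℂ) *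
        single_one_mul_single_neg_one
  rw [key, HahnSeries.coeff_single_mul_add, one_mul, LaurentSeries.coeff_coe_powerSeries]
  simp

end

/-! ### Poles, residues and expansion at infinity of $\psi_\pi$ -/

section

variable {h₁ h₂ h₃ : ℂ}

open PlanePartition

theorem boxWeight_eq_of_onDiag (hsum : h₁ + h₂ + h₃ = 0) {b : Box} {p q : ℤ} (h : OnDiag b p q) :
    boxWeight h₁ h₂ h₃ b = h₁ * q + h₂ * p := by
  obtain ⟨rfl, rfl⟩ := h
  rw [boxWeight]
  push_cast
  linear_combination (b.2.2 : ℂ) * hsum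

theorem onDiag_self (b : Box) : OnDiag b ((b.1 : ℤ) - b.2.2) ((b.2.1 : ℤ) - b.2.2) := ⟨rfl, rfl⟩

/-- For generic parameters the weight of a box determines its diagonal. -/
theorem boxWeight_eq_iff (hsum : h₁ + h₂ + h₃ = 0)
    (hgen : ∀ a b : ℤ, (a : ℂ) * h₁ + (b : ℂ) * h₂ = 0 → a = 0 ∧ b = 0) (b : Box) (p q : ℤ) :
    boxWeight h₁ h₂ h₃ b = h₁ * q + h₂ * p ↔ OnDiag b p q := by
  refine ⟨fun h => ?_, boxWeight_eq_of_onDiag hsum⟩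
  rw [boxWeight_eq_of_onDiag hsum (onDiag_self b)] at h
  have := hgen ((b.2.1 : ℤ) - b.2.2 - q) ((b.1 : ℤ) - b.2.2 - p) (by
    push_cast at h ⊢
    linear_combination h)
  constructor <;> omega

theorem sigmaThree_ne_zero (hsum : h₁ + h₂ + h₃ = 0)
    (hgen : ∀ a b : ℤ, (a : ℂ) * h₁ + (b : ℂ) * h₂ = 0 → a = 0 ∧ b = 0) :
    h₁ ≠ 0 ∧ h₂ ≠ 0 ∧ h₃ ≠ 0 ∧ sigmaThree h₁ h₂ h₃ ≠ 0 := by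
  have e1 : h₁ ≠ 0 := fun h => by simpa using hgen 1 0 (by simp [h])
  have e2 : h₂ ≠ 0 := fun h => by simpa using hgen 0 1 (by simp [h])
  have e3 : h₃ ≠ 0 := fun h => by
    simpa using hgen 1 1 (by push_cast; linear_combination hsum - h)
  exact ⟨e1, e2, e3, mul_ne_zero (mul_ne_zero e1 e2) e3⟩

variable (h₁ h₂ h₃) in
/-- The zeros of `ψ_π`, before cancellation. -/
def psiZeros (π : PlanePartition) : Multiset ℂ :=
  (-sigmaThree h₁ h₂ h₃) ::ₘ (π.cells.val.map (fun b => boxWeight h₁ h₂ h₃ b - h₁) +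
    π.cells.val.map (fun b => boxWeight h₁ h₂ h₃ b - h₂) +
    π.cells.val.map (fun b => boxWeight h₁ h₂ h₃ b - h₃))

variable (h₁ h₂ h₃) in
/-- The poles of `ψ_π`, before cancellation. -/
def psiPoles (π : PlanePartition) : Multiset ℂ :=
  0 ::ₘ (π.cells.val.map (fun b => boxWeight h₁ h₂ h₃ b + h₁) +
    π.cells.val.map (fun b => boxWeight h₁ h₂ h₃ b + h₂) +
    π.cells.val.map (fun b => boxWeight h₁ h₂ h₃ b + h₃))

theorem psiFun_eq_div (π : PlanePartition) (u : LaurentSeries ℂ) :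
    psiFun h₁ h₂ h₃ π u =
      ((psiZeros h₁ h₂ h₃ π).map fun a => u - HahnSeries.C a).prod /
        ((psiPoles h₁ h₂ h₃ π).map fun a => u - HahnSeries.C a).prod := by
  have hprod (f : Box → LaurentSeries ℂ) : (π.cells.val.map f).prod = ∏ b ∈ π.cells, f b := rfl
  simp only [psiZeros, psiPoles, Multiset.map_cons, Multiset.map_add, Multiset.prod_cons,
    Multiset.prod_add, Multiset.map_map, hprod, Function.comp_apply, psiFun, phi]
  rw [Finset.prod_div_distrib, div_mul_div_comm]
  simp only [Finset.prod_mul_distrib, map_neg, map_zero, map_sub, map_add, sub_neg_eq_add, sub_zero,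
    sub_sub, sub_sub_eq_add_sub, sub_add_eq_add_sub]

theorem count_map_boxWeight (hsum : h₁ + h₂ + h₃ = 0)
    (hgen : ∀ a b : ℤ, (a : ℂ) * h₁ + (b : ℂ) * h₂ = 0 → a = 0 ∧ b = 0) (π : PlanePartition)
    (s w : ℂ) (p q : ℤ) (h : w - s = h₁ * q + h₂ * p) :
    (π.cells.val.map fun b => boxWeight h₁ h₂ h₃ b + s).count w = π.diagCount p q := by
  rw [Multiset.count_map, diagCount, Finset.card_def, Finset.filter_val]
  congr 1
  refine Multiset.filter_congr fun b _ => ?_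
  rw [← boxWeight_eq_iff hsum hgen, ← h, eq_sub_iff_add_eq, eq_comm]

theorem count_map_boxWeight_eq_zero (hsum : h₁ + h₂ + h₃ = 0) (π : PlanePartition)
    (s w : ℂ) (h : ∀ p q : ℤ, w - s ≠ h₁ * q + h₂ * p) :
    (π.cells.val.map fun b => boxWeight h₁ h₂ h₃ b + s).count w = 0 := by
  rw [Multiset.count_eq_zero, Multiset.mem_map]
  rintro ⟨b, _, rfl⟩
  exact h _ _ ((add_sub_cancel_right _ _).trans (boxWeight_eq_of_onDiag hsum (onDiag_self b)))

/-- The boxes that can be added to or removed from `π`. -/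
def cornerBoxes (π : PlanePartition) : Finset Box := π.addableBoxes ∪ π.removableBoxes

theorem mem_cornerBoxes {π : PlanePartition} {b : Box} : b ∈ cornerBoxes π ↔ π.IsCorner b := by
  simp [cornerBoxes, addableBoxes, removableBoxes, PlanePartition.IsCorner]

theorem injOn_boxWeight (hsum : h₁ + h₂ + h₃ = 0)
    (hgen : ∀ a b : ℤ, (a : ℂ) * h₁ + (b : ℂ) * h₂ = 0 → a = 0 ∧ b = 0) (π : PlanePartition) :
    Set.InjOn (boxWeight h₁ h₂ h₃) (cornerBoxes π) := by
  intro b hb c hc h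
  rw [Finset.mem_coe, mem_cornerBoxes] at hb hc
  rw [boxWeight_eq_of_onDiag hsum (onDiag_self c), boxWeight_eq_iff hsum hgen] at h
  exact hb.eq_of_onDiag hc h (onDiag_self c)

/-- Comparing multisets before cancellation turns "only simple poles, at corners" into the count
`diagCount_le` on each diagonal. The zero at $-\sigma_3$ can only help, wherever it falls. -/
theorem psiPoles_le (hsum : h₁ + h₂ + h₃ = 0)
    (hgen : ∀ a b : ℤ, (a : ℂ) * h₁ + (b : ℂ) * h₂ = 0 → a = 0 ∧ b = 0) (π : PlanePartition) :
    psiPoles h₁ h₂ h₃ π ≤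
      psiZeros h₁ h₂ h₃ π + ((cornerBoxes π).image (boxWeight h₁ h₂ h₃)).val := by
  classical
  rw [Multiset.le_iff_count]
  intro w
  simp only [psiPoles, psiZeros, Multiset.count_add, Multiset.count_cons, sub_eq_add_neg]
  by_cases hw : ∃ p q : ℤ, w = h₁ * q + h₂ * p
  · obtain ⟨p, q, hw⟩ := hw
    have key := π.diagCount_le p q
    -- Adding $h_1$, $h_2$, $h_3$ to a weight moves the diagonal $(p,q)$ by $(0,1)$, $(1,0)$,
    -- $(-1,-1)$, the last because $h_3=-h_1-h_2$.
    rw [count_map_boxWeight hsum hgen π h₁ w p (q - 1) (by push_cast; linear_combination hw),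
      count_map_boxWeight hsum hgen π h₂ w (p - 1) q (by push_cast; linear_combination hw),
      count_map_boxWeight hsum hgen π h₃ w (p + 1) (q + 1)
        (by push_cast; linear_combination hw - hsum),
      count_map_boxWeight hsum hgen π (-h₁) w p (q + 1) (by push_cast; linear_combination hw),
      count_map_boxWeight hsum hgen π (-h₂) w (p + 1) q (by push_cast; linear_combination hw),
      count_map_boxWeight hsum hgen π (-h₃) w (p - 1) (q - 1)
        (by push_cast; linear_combination hw + hsum)]
    have hz : (if w = 0 then 1 else 0) = if p = 0 ∧ q = 0 then 1 else 0 := by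
      refine if_congr ⟨fun h => ?_, fun h => by rw [hw, h.1, h.2]; simp⟩ rfl rfl
      exact (hgen q p (by linear_combination h - hw)).symm
    have hc : (if ∃ b, OnDiag b p q ∧ π.IsCorner b then 1 else 0) ≤
        ((cornerBoxes π).image (boxWeight h₁ h₂ h₃)).val.count w := by
      split_ifs with h
      · obtain ⟨b, hb, hb'⟩ := h
        rw [Multiset.one_le_count_iff_mem, Finset.mem_val, Finset.mem_image]
        exact ⟨b, mem_cornerBoxes.2 hb', by rw [hw, boxWeight_eq_of_onDiag hsum hb]⟩
      · exact Nat.zero_le _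
    rw [hz]
    omega
  · push Not at hw
    rw [count_map_boxWeight_eq_zero hsum π h₁ w fun p q h => hw p (q + 1) (by
        push_cast; linear_combination h),
      count_map_boxWeight_eq_zero hsum π h₂ w fun p q h => hw (p + 1) q (by
        push_cast; linear_combination h),
      count_map_boxWeight_eq_zero hsum π h₃ w fun p q h => hw (p - 1) (q - 1) (by
        push_cast; linear_combination h + hsum)]
    rw [if_neg fun h => hw 0 0 (by simpa using h)]
    exact Nat.zero_le _

/-- One set of coefficients `r` serves every `u`. Taking $u=a+t$ reads off residues and $u=t^{-1}$
the eigenvalues of $\psi_j$, so comparing the two is the residue theorem. -/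
theorem exists_psiFun_partialFractions (hsum : h₁ + h₂ + h₃ = 0)
    (hgen : ∀ a b : ℤ, (a : ℂ) * h₁ + (b : ℂ) * h₂ = 0 → a = 0 ∧ b = 0) (π : PlanePartition) :
    ∃ r : ℂ → ℂ, ∀ u : LaurentSeries ℂ, (∀ a, u - HahnSeries.C a ≠ 0) →
      psiFun h₁ h₂ h₃ π u =
        1 + ∑ a ∈ (cornerBoxes π).image (boxWeight h₁ h₂ h₃),
          HahnSeries.C (r a) / (u - HahnSeries.C a) := by
  -- `R` is the numerator left after cancellation against the denominator $\prod(u-h_\square)$ over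
  -- the corners. Its degree matches because $\psi_\pi$ has as many zeros as poles.
  obtain ⟨R, hR⟩ := Multiset.le_iff_exists_add.1 (psiPoles_le hsum hgen π)
  have hcard := congrArg Multiset.card hR
  simp only [psiPoles, psiZeros, Multiset.card_add, Multiset.card_cons, Multiset.card_map,
    Finset.card_val] at hcard
  obtain ⟨r, hr⟩ := exists_partialFractions _ R
    (show R.card = ((cornerBoxes π).image (boxWeight h₁ h₂ h₃)).card by omega)
  refine ⟨r, fun u hu => ?_⟩
  rw [← hr HahnSeries.C u hu, psiFun_eq_div, div_eq_div_iff]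
  · have := congrArg (fun m : Multiset ℂ => (m.map fun a => u - HahnSeries.C a).prod) hR
    simp only [Multiset.map_add, Multiset.prod_add] at this
    rw [mul_comm _ (Multiset.prod _), ← this]
    rfl
  · refine Multiset.prod_ne_zero fun h => ?_
    obtain ⟨a, _, ha⟩ := Multiset.mem_map.1 h
    exact hu a ha
  · exact Finset.prod_ne_zero_iff.2 fun a _ => hu a


theorem psiFun_expansion_of_partialFractions {π : PlanePartition} {S : Finset ℂ} {r : ℂ → ℂ}
    (hr : ∀ u : LaurentSeries ℂ, (∀ a, u - HahnSeries.C a ≠ 0) →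
      psiFun h₁ h₂ h₃ π u = 1 + ∑ a ∈ S, HahnSeries.C (r a) / (u - HahnSeries.C a)) (a : ℂ) :
    residue h₁ h₂ h₃ π a = (if a ∈ S then r a else 0) ∧ ∃ g : PowerSeries ℂ,
      psiFun h₁ h₂ h₃ π (HahnSeries.C a + HahnSeries.single 1 1) =
        HahnSeries.single (-1) (residue h₁ h₂ h₃ π a) + (g : LaurentSeries ℂ) := by
  obtain ⟨g, hg⟩ := exists_sum_C_div_eq_single_add S r a
  have h := hr _ (C_add_single_ne_C a)
  rw [hg] at h
  have hres : residue h₁ h₂ h₃ π a = if a ∈ S then r a else 0 := by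
    rw [residue, h, HahnSeries.coeff_add, HahnSeries.coeff_add, coeff_coe_neg_one,
      ← PowerSeries.coe_one, coeff_coe_neg_one]
    simp
  refine ⟨hres, 1 + g, ?_⟩
  rw [h, hres, PowerSeries.coe_add, PowerSeries.coe_one]
  ring

/-- `ψ_π` has at most simple poles. -/
theorem exists_psiFun_eq_single_add (hsum : h₁ + h₂ + h₃ = 0)
    (hgen : ∀ a b : ℤ, (a : ℂ) * h₁ + (b : ℂ) * h₂ = 0 → a = 0 ∧ b = 0) (π : PlanePartition)
    (a : ℂ) : ∃ g : PowerSeries ℂ,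
      psiFun h₁ h₂ h₃ π (HahnSeries.C a + HahnSeries.single 1 1) =
        HahnSeries.single (-1) (residue h₁ h₂ h₃ π a) + (g : LaurentSeries ℂ) := by
  obtain ⟨r, hr⟩ := exists_psiFun_partialFractions hsum hgen π
  exact (psiFun_expansion_of_partialFractions hr a).2

/-- The residue theorem for `u^j ψ_π(u)`. -/
theorem psiEigenvalue_eq_sum_residue (hsum : h₁ + h₂ + h₃ = 0)
    (hgen : ∀ a b : ℤ, (a : ℂ) * h₁ + (b : ℂ) * h₂ = 0 → a = 0 ∧ b = 0) (π : PlanePartition)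
    (j : ℕ) : psiEigenvalue h₁ h₂ h₃ π j = (sigmaThree h₁ h₂ h₃)⁻¹ *
      ∑ b ∈ cornerBoxes π, boxWeight h₁ h₂ h₃ b ^ j *
        residue h₁ h₂ h₃ π (boxWeight h₁ h₂ h₃ b) := by
  obtain ⟨r, hr⟩ := exists_psiFun_partialFractions hsum hgen π
  rw [psiEigenvalue, hr _ single_neg_one_ne_C, HahnSeries.coeff_add, HahnSeries.coeff_sum,
    HahnSeries.coeff_one, if_neg (by omega), zero_add,
    Finset.sum_image (injOn_boxWeight hsum hgen π)]
  congr 1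
  refine Finset.sum_congr rfl fun b hb => ?_
  rw [coeff_C_div_single_neg_one, (psiFun_expansion_of_partialFractions hr _).1,
    if_pos (Finset.mem_image_of_mem _ hb), mul_comm]

theorem psiFun_insert {π π' : PlanePartition} {b : Box} (hb : b ∉ π'.cells)
    (h : π.cells = insert b π'.cells) (u : LaurentSeries ℂ) :
    psiFun h₁ h₂ h₃ π u =
      psiFun h₁ h₂ h₃ π' u * phi h₁ h₂ h₃ (u - HahnSeries.C (boxWeight h₁ h₂ h₃ b)) := by
  rw [psiFun, psiFun, h, Finset.prod_insert hb]
  ring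

theorem exists_phi_single_one (e1 : h₁ ≠ 0) (e2 : h₂ ≠ 0) (e3 : h₃ ≠ 0) :
    ∃ g : PowerSeries ℂ, phi h₁ h₂ h₃ (HahnSeries.single 1 1) = (g : LaurentSeries ℂ) ∧
      PowerSeries.constantCoeff g = -1 := by
  have hd : PowerSeries.constantCoeff ((PowerSeries.X - PowerSeries.C h₁) *
      (PowerSeries.X - PowerSeries.C h₂) * (PowerSeries.X - PowerSeries.C h₃)) ≠ 0 := by
    simp [e1, e2, e3]
  refine ⟨(PowerSeries.X + PowerSeries.C h₁) * (PowerSeries.X + PowerSeries.C h₂) *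
    (PowerSeries.X + PowerSeries.C h₃) * ((PowerSeries.X - PowerSeries.C h₁) *
      (PowerSeries.X - PowerSeries.C h₂) * (PowerSeries.X - PowerSeries.C h₃))⁻¹, ?_, ?_⟩
  · rw [PowerSeries.coe_mul, ← inv_coe hd, ← div_eq_mul_inv]
    simp only [PowerSeries.coe_mul, PowerSeries.coe_add, PowerSeries.coe_sub, PowerSeries.coe_C,
      PowerSeries.coe_X, phi]
  · rw [map_mul, PowerSeries.constantCoeff_inv]
    simp
    field_simp

/-- The extra factor is $\varphi(u-h_b)$, with $\varphi(0)=-1$. The pole of $\psi_{\pi'}$ at $h_b$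
is at most simple, so no further coefficient of $\varphi$ enters. -/
theorem residue_insert (hsum : h₁ + h₂ + h₃ = 0)
    (hgen : ∀ a b : ℤ, (a : ℂ) * h₁ + (b : ℂ) * h₂ = 0 → a = 0 ∧ b = 0) {π π' : PlanePartition}
    {b : Box} (hb : b ∉ π'.cells) (h : π.cells = insert b π'.cells) :
    residue h₁ h₂ h₃ π (boxWeight h₁ h₂ h₃ b) = -residue h₁ h₂ h₃ π' (boxWeight h₁ h₂ h₃ b) := by
  obtain ⟨e1, e2, e3, -⟩ := sigmaThree_ne_zero hsum hgen
  obtain ⟨g, hg⟩ := exists_psiFun_eq_single_add hsum hgen π' (boxWeight h₁ h₂ h₃ b)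
  obtain ⟨g', hg', hc⟩ := exists_phi_single_one e1 e2 e3
  rw [residue, psiFun_insert hb h, hg, add_sub_cancel_left, hg', add_mul, HahnSeries.coeff_add,
    ← PowerSeries.coe_mul, coeff_coe_neg_one, add_zero]
  have := HahnSeries.coeff_single_mul_add (r := residue h₁ h₂ h₃ π' (boxWeight h₁ h₂ h₃ b))
    (x := (g' : LaurentSeries ℂ)) (a := 0) (b := (-1 : ℤ))
  rw [zero_add] at this
  rw [this, ← Int.natCast_zero, LaurentSeries.coeff_coe_powerSeries,
    PowerSeries.coeff_zero_eq_constantCoeff_apply, hc]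
  ring

/-! ### Expansion at infinity -/

/-- When $h_1+h_2+h_3=0$, numerator and denominator of $\varphi$ differ by the constant $2\sigma_3$,
so $\varphi(u)=1+2\sigma_3/\prod(u-h_i)$. The series `d` is the denominator at $u-w$ multiplied by
$t^3$, a unit. -/
theorem exists_phi_at_infinity (hsum : h₁ + h₂ + h₃ = 0) (w : ℂ) : ∃ g : PowerSeries ℂ,
    phi h₁ h₂ h₃ (HahnSeries.single (-1) 1 - HahnSeries.C w) =
      ((1 + PowerSeries.X ^ 3 * (PowerSeries.C (2 * sigmaThree h₁ h₂ h₃) + PowerSeries.X * g) :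
        PowerSeries ℂ) : LaurentSeries ℂ) := by
  set d : PowerSeries ℂ := (1 - PowerSeries.C (w + h₁) * PowerSeries.X) *
    (1 - PowerSeries.C (w + h₂) * PowerSeries.X) * (1 - PowerSeries.C (w + h₃) * PowerSeries.X)
    with hd
  have hd1 : PowerSeries.constantCoeff d = 1 := by simp [hd]
  have hd0 : PowerSeries.constantCoeff d ≠ 0 := by simp [hd1]
  obtain ⟨g, hg⟩ : PowerSeries.X ∣ d⁻¹ - 1 := by
    rw [PowerSeries.X_dvd_iff, map_sub, PowerSeries.constantCoeff_inv, hd1]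
    simp
  refine ⟨PowerSeries.C (2 * sigmaThree h₁ h₂ h₃) * g, ?_⟩
  have hg' : d⁻¹ = 1 + PowerSeries.X * g := by rw [← hg]; ring
  have hinv := inv_coe hd0
  rw [show PowerSeries.C (2 * sigmaThree h₁ h₂ h₃) + PowerSeries.X *
      (PowerSeries.C (2 * sigmaThree h₁ h₂ h₃) * g) = PowerSeries.C (2 * sigmaThree h₁ h₂ h₃) *
      d⁻¹ by rw [hg']; ring]
  have hdne : (d : LaurentSeries ℂ) ≠ 0 := left_ne_zero_of_mul_eq_one (coe_mul_coe_inv hd0)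
  simp only [PowerSeries.coe_add, PowerSeries.coe_mul, PowerSeries.coe_one, PowerSeries.coe_pow,
    PowerSeries.coe_C, PowerSeries.coe_X, ← hinv]
  have hs := single_one_mul_single_neg_one
  have hdc : (d : LaurentSeries ℂ) = (1 - HahnSeries.C (w + h₁) * HahnSeries.single 1 1) *
      (1 - HahnSeries.C (w + h₂) * HahnSeries.single 1 1) *
      (1 - HahnSeries.C (w + h₃) * HahnSeries.single 1 1) := by
    simp only [hd, PowerSeries.coe_mul, PowerSeries.coe_one, PowerSeries.coe_C, PowerSeries.coe_X,
      PowerSeries.coe_sub]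
  have ht : (HahnSeries.single 1 1 : LaurentSeries ℂ) ≠ 0 := by simp
  have hu : (HahnSeries.single (-1) 1 : LaurentSeries ℂ) = (HahnSeries.single 1 1)⁻¹ :=
    (inv_eq_of_mul_eq_one_right hs).symm
  have hC : (HahnSeries.C h₃ : LaurentSeries ℂ) = -HahnSeries.C h₁ - HahnSeries.C h₂ := by
    rw [← map_neg, ← map_sub]
    congr 1
    linear_combination hsum
  have hn (c : ℂ) : (HahnSeries.single (-1) 1 - HahnSeries.C w - HahnSeries.C c :
      LaurentSeries ℂ) ≠ 0 := by
    rw [sub_sub, ← map_add]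
    exact single_neg_one_ne_C _
  rw [phi, div_eq_iff (mul_ne_zero (mul_ne_zero (hn _) (hn _)) (hn _))]
  have hd3 : (HahnSeries.single (-1) 1 - HahnSeries.C w - HahnSeries.C h₁ : LaurentSeries ℂ) *
      (HahnSeries.single (-1) 1 - HahnSeries.C w - HahnSeries.C h₂) *
      (HahnSeries.single (-1) 1 - HahnSeries.C w - HahnSeries.C h₃) =
      (d : LaurentSeries ℂ) * ((HahnSeries.single 1 1)⁻¹) ^ 3 := by
    rw [hu, hdc]
    simp only [map_add]
    field_simp
    ring
  rw [add_mul 1, one_mul, hd3, show HahnSeries.single (1 : ℤ) (1 : ℂ) ^ 3 *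
      (HahnSeries.C (2 * sigmaThree h₁ h₂ h₃) * (d : LaurentSeries ℂ)⁻¹) *
      ((d : LaurentSeries ℂ) * (HahnSeries.single (1 : ℤ) (1 : ℂ))⁻¹ ^ 3) =
      HahnSeries.C (2 * sigmaThree h₁ h₂ h₃) by field_simp, ← hd3, sigmaThree]
  simp only [map_mul, hC, map_ofNat]
  ring

/-- Each box contributes $2\sigma_3$ in order $t^3$ and nothing earlier. The orders $t^2$ and $t^3$
then give the eigenvalues $\psi_1=0$ and $\psi_2=2|\pi|$. -/
theorem exists_psiFun_at_infinity (hsum : h₁ + h₂ + h₃ = 0) (π : PlanePartition) :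
    ∃ g : PowerSeries ℂ, psiFun h₁ h₂ h₃ π (HahnSeries.single (-1) 1) =
      (((1 + PowerSeries.C (sigmaThree h₁ h₂ h₃) * PowerSeries.X) * (1 + PowerSeries.X ^ 3 *
        (PowerSeries.C (2 * sigmaThree h₁ h₂ h₃ * π.cells.card) + PowerSeries.X * g)) :
        PowerSeries ℂ) : LaurentSeries ℂ) := by
  have hprod : ∀ s : Finset Box, ∃ g : PowerSeries ℂ,
      ∏ b ∈ s, phi h₁ h₂ h₃ (HahnSeries.single (-1) 1 -
        HahnSeries.C (boxWeight h₁ h₂ h₃ b)) = ((1 + PowerSeries.X ^ 3 *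
        (PowerSeries.C (2 * sigmaThree h₁ h₂ h₃ * s.card) + PowerSeries.X * g) : PowerSeries ℂ) :
        LaurentSeries ℂ) := by
    classical
    intro s
    induction s using Finset.induction_on with
    | empty => exact ⟨0, by simp⟩
    | insert b s hb ih =>
      obtain ⟨g, hg⟩ := ih
      obtain ⟨g', hg'⟩ := exists_phi_at_infinity hsum (boxWeight h₁ h₂ h₃ b)
      refine ⟨g + g' + PowerSeries.X ^ 2 * (PowerSeries.C (2 * sigmaThree h₁ h₂ h₃) +
        PowerSeries.X * g') * (PowerSeries.C (2 * sigmaThree h₁ h₂ h₃ * s.card) +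
        PowerSeries.X * g), ?_⟩
      rw [Finset.prod_insert hb, hg, hg', ← PowerSeries.coe_mul, Finset.card_insert_of_notMem hb]
      congr 1
      simp only [map_mul, Nat.cast_add, map_add, Nat.cast_one, map_one]
      ring
  obtain ⟨g, hg⟩ := hprod π.cells
  refine ⟨g, ?_⟩
  rw [psiFun, hg, PowerSeries.coe_mul]
  congr 1
  rw [div_eq_iff (by simp)]
  simp only [PowerSeries.coe_add, PowerSeries.coe_mul, PowerSeries.coe_one, PowerSeries.coe_C,
    PowerSeries.coe_X]
  linear_combination (-HahnSeries.C (sigmaThree h₁ h₂ h₃)) * single_one_mul_single_neg_one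

theorem psiEigenvalue_one (hsum : h₁ + h₂ + h₃ = 0) (π : PlanePartition) :
    psiEigenvalue h₁ h₂ h₃ π 1 = 0 := by
  obtain ⟨g, hg⟩ := exists_psiFun_at_infinity hsum π
  rw [psiEigenvalue, hg, show ((1 : ℕ) : ℤ) + 1 = ((2 : ℕ) : ℤ) by norm_num,
    LaurentSeries.coeff_coe_powerSeries]
  set c := PowerSeries.C (2 * sigmaThree h₁ h₂ h₃ * (π.cells.card : ℂ)) + PowerSeries.X * g
  rw [show (1 + PowerSeries.C (sigmaThree h₁ h₂ h₃) * PowerSeries.X) *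
      (1 + PowerSeries.X ^ 3 * c) = 1 + PowerSeries.C (sigmaThree h₁ h₂ h₃) * PowerSeries.X +
      PowerSeries.X ^ 3 * (c + PowerSeries.C (sigmaThree h₁ h₂ h₃) * PowerSeries.X * c) by ring]
  simp [PowerSeries.coeff_X_pow_mul', PowerSeries.coeff_one]

theorem psiEigenvalue_two (hsum : h₁ + h₂ + h₃ = 0) (hs : sigmaThree h₁ h₂ h₃ ≠ 0)
    (π : PlanePartition) : psiEigenvalue h₁ h₂ h₃ π 2 = 2 * π.cells.card := by
  obtain ⟨g, hg⟩ := exists_psiFun_at_infinity hsum π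
  rw [psiEigenvalue, hg, show ((2 : ℕ) : ℤ) + 1 = ((3 : ℕ) : ℤ) by norm_num,
    LaurentSeries.coeff_coe_powerSeries]
  set c := PowerSeries.C (2 * sigmaThree h₁ h₂ h₃ * (π.cells.card : ℂ)) with hc
  rw [show (1 + PowerSeries.C (sigmaThree h₁ h₂ h₃) * PowerSeries.X) *
      (1 + PowerSeries.X ^ 3 * (c + PowerSeries.X * g)) =
      1 + PowerSeries.C (sigmaThree h₁ h₂ h₃) * PowerSeries.X + PowerSeries.X ^ 3 * (c +
      PowerSeries.X * (g + PowerSeries.C (sigmaThree h₁ h₂ h₃) * (c + PowerSeries.X * g))) by ring]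
  rw [map_add, PowerSeries.coeff_X_pow_mul', if_pos le_rfl, Nat.sub_self]
  simp only [map_add, PowerSeries.coeff_zero_X_mul, hc, PowerSeries.coeff_zero_C,
    PowerSeries.coeff_C_mul, PowerSeries.coeff_X, PowerSeries.coeff_one]
  simp
  field_simp

end

/-! ### The operators on plane partitions -/

section

namespace PlanePartition

variable {π : PlanePartition} {b c : Box}

theorem mem_addableBoxes : b ∈ π.addableBoxes ↔ π.Addable b := by simp [addableBoxes]

theorem mem_removableBoxes : b ∈ π.removableBoxes ↔ π.Removable b := by simp [removableBoxes]

theorem cells_add (h : π.Addable b) : (π.add b).cells = insert b π.cells := by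
  rw [add, dif_pos h.2]

theorem cells_remove (h : π.Removable b) : (π.remove b).cells = π.cells.erase b := by
  rw [remove, dif_pos h.2]

theorem addable_remove (h : π.Removable b) : (π.remove b).Addable b := by
  rw [Addable, cells_remove h, Finset.insert_erase h.1]
  exact ⟨by simp, π.isLowerSet⟩

theorem removable_add (h : π.Addable b) : (π.add b).Removable b := by
  rw [Removable, cells_add h, Finset.erase_insert h.1]
  exact ⟨by simp, π.isLowerSet⟩

theorem add_remove (h : π.Removable b) : (π.remove b).add b = π := by
  ext1
  rw [cells_add (addable_remove h), cells_remove h, Finset.insert_erase h.1]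

theorem remove_add (h : π.Addable b) : (π.add b).remove b = π := by
  ext1
  rw [cells_remove (removable_add h), cells_add h, Finset.erase_insert h.1]

/-- This matches the pairs of boxes occurring in $e_jf_k$ with those in $f_ke_j$, so that the two
double sums can be exchanged. -/
theorem removable_and_addable_iff (hne : b ≠ c) :
    π.Removable c ∧ (π.remove c).Addable b ↔ π.Addable b ∧ (π.add b).Removable c := by
  constructor
  · rintro ⟨hc, hb⟩
    rw [Addable, cells_remove hc] at hb
    have hb' : b ∉ π.cells := fun h => hb.1 (Finset.mem_erase.2 ⟨hne, h⟩)
    have hadd : π.Addable b := by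
      refine ⟨hb', ?_⟩
      have := hb.2.union π.isLowerSet
      convert this using 1
      ext x
      simp only [Finset.coe_insert, Set.mem_insert_iff, Finset.mem_coe, Finset.coe_erase,
        Set.mem_union, Set.mem_sdiff]
      tauto
    refine ⟨hadd, ?_⟩
    rw [Removable, cells_add hadd, Finset.erase_insert_of_ne hne]
    exact ⟨Finset.mem_insert_of_mem hc.1, hb.2⟩
  · rintro ⟨hb, hc⟩
    rw [Removable, cells_add hb, Finset.erase_insert_of_ne hne] at hc
    have hc' : c ∈ π.cells := (Finset.mem_insert.1 hc.1).resolve_left hne.symm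
    have hrem : π.Removable c := by
      refine ⟨hc', ?_⟩
      have := hc.2.inter π.isLowerSet
      convert this using 1
      ext x
      have hb1 := hb.1
      simp only [Finset.coe_insert, Set.mem_insert_iff, Finset.mem_coe, Finset.coe_erase,
        Set.mem_inter_iff, Set.mem_sdiff, Set.mem_singleton_iff]
      constructor
      · tauto
      · rintro ⟨rfl | h, h'⟩
        · exact absurd h' hb1
        · exact h
    refine ⟨hrem, ?_⟩
    rw [Addable, cells_remove hrem]
    exact ⟨fun h => hb.1 (Finset.mem_of_mem_erase h), hc.2⟩

theorem add_remove_comm (hne : b ≠ c) (hc : π.Removable c) (hb : (π.remove c).Addable b) :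
    (π.remove c).add b = (π.add b).remove c := by
  obtain ⟨hb', hc'⟩ := (removable_and_addable_iff hne).1 ⟨hc, hb⟩
  ext1
  rw [cells_add hb, cells_remove hc, cells_remove hc', cells_add hb',
    Finset.erase_insert_of_ne hne]

end PlanePartition

open PlanePartition

variable {h₁ h₂ h₃ : ℂ} {E : PlanePartition → Box → ℂ}

theorem ppE_ket (j : ℕ) (π : PlanePartition) : ppE h₁ h₂ h₃ E j (ket π) =
    ∑ b ∈ π.addableBoxes, (boxWeight h₁ h₂ h₃ b ^ j * E π b) • ket (π.add b) := by
  simp [ppE, ket]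

theorem ppF_ket (j : ℕ) (π : PlanePartition) : ppF h₁ h₂ h₃ E j (ket π) =
    ∑ b ∈ π.removableBoxes, (boxWeight h₁ h₂ h₃ b ^ j * (-E (π.remove b) b)) •
      ket (π.remove b) := by
  simp [ppF, ket]

theorem ppPsi_ket (j : ℕ) (π : PlanePartition) :
    ppPsi h₁ h₂ h₃ j (ket π) = psiEigenvalue h₁ h₂ h₃ π j • ket π := by
  simp [ppPsi, ket]

theorem end_ext {S T : Module.End ℂ PPSpace} (h : ∀ π, S (ket π) = T (ket π)) : S = T := by
  ext π : 2
  simpa [ket] using h π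

/-- The first sum collects the returns to `π`, where the removed box is put back; the second sum
moves a box. `ppF_ppE_ket` is split the same way. -/
theorem ppE_ppF_ket (j k : ℕ) (π : PlanePartition) :
    ppE h₁ h₂ h₃ E j (ppF h₁ h₂ h₃ E k (ket π)) =
      (∑ c ∈ π.removableBoxes, (-(boxWeight h₁ h₂ h₃ c ^ (j + k) * E (π.remove c) c ^ 2))) • ket π +
      ∑ c ∈ π.removableBoxes, ∑ b ∈ (π.remove c).addableBoxes.erase c,
        (-(boxWeight h₁ h₂ h₃ c ^ k * boxWeight h₁ h₂ h₃ b ^ j *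
          (E (π.remove c) b * E (π.remove c) c))) • ket ((π.remove c).add b) := by
  rw [ppF_ket, map_sum, Finset.sum_smul, ← Finset.sum_add_distrib]
  refine Finset.sum_congr rfl fun c hc => ?_
  rw [mem_removableBoxes] at hc
  rw [map_smul, ppE_ket, ← Finset.add_sum_erase _ _ (mem_addableBoxes.2 (addable_remove hc)),
    smul_add, add_remove hc, smul_smul, Finset.smul_sum]
  congr 1
  · congr 1
    ring
  · refine Finset.sum_congr rfl fun b _ => ?_
    rw [smul_smul]
    congr 1
    ring

theorem ppF_ppE_ket (j k : ℕ) (π : PlanePartition) :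
    ppF h₁ h₂ h₃ E k (ppE h₁ h₂ h₃ E j (ket π)) =
      (∑ b ∈ π.addableBoxes, (-(boxWeight h₁ h₂ h₃ b ^ (j + k) * E π b ^ 2))) • ket π +
      ∑ b ∈ π.addableBoxes, ∑ c ∈ (π.add b).removableBoxes.erase b,
        (-(boxWeight h₁ h₂ h₃ c ^ k * boxWeight h₁ h₂ h₃ b ^ j *
          (E π b * E ((π.add b).remove c) c))) • ket ((π.add b).remove c) := by
  rw [ppE_ket, map_sum, Finset.sum_smul, ← Finset.sum_add_distrib]
  refine Finset.sum_congr rfl fun b hb => ?_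
  rw [mem_addableBoxes] at hb
  rw [map_smul, ppF_ket, ← Finset.add_sum_erase _ _ (mem_removableBoxes.2 (removable_add hb)),
    smul_add, remove_add hb, smul_smul, Finset.smul_sum]
  congr 1
  · congr 1
    ring
  · refine Finset.sum_congr rfl fun c _ => ?_
    rw [smul_smul]
    congr 1
    ring

/-- The relation `[e_j, f_k] = ψ_{j+k}` on plane partitions. -/
theorem bracket_ppE_ppF (hsum : h₁ + h₂ + h₃ = 0)
    (hgen : ∀ a b : ℤ, (a : ℂ) * h₁ + (b : ℂ) * h₂ = 0 → a = 0 ∧ b = 0)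
    (hE : IsRootChoice h₁ h₂ h₃ E) (j k : ℕ) :
    ⁅ppE h₁ h₂ h₃ E j, ppF h₁ h₂ h₃ E k⁆ = ppPsi h₁ h₂ h₃ (j + k) := by
  refine end_ext fun π => ?_
  rw [Ring.lie_def, LinearMap.sub_apply, Module.End.mul_apply, Module.End.mul_apply, ppE_ppF_ket,
    ppF_ppE_ket, ppPsi_ket]
  have hoff : (∑ c ∈ π.removableBoxes, ∑ b ∈ (π.remove c).addableBoxes.erase c,
        (-(boxWeight h₁ h₂ h₃ c ^ k * boxWeight h₁ h₂ h₃ b ^ j *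
          (E (π.remove c) b * E (π.remove c) c))) • ket ((π.remove c).add b)) =
      ∑ b ∈ π.addableBoxes, ∑ c ∈ (π.add b).removableBoxes.erase b,
        (-(boxWeight h₁ h₂ h₃ c ^ k * boxWeight h₁ h₂ h₃ b ^ j *
          (E π b * E ((π.add b).remove c) c))) • ket ((π.add b).remove c) := by
    have hmem : ∀ c b, c ∈ π.removableBoxes ∧ b ∈ (π.remove c).addableBoxes.erase c ↔
        c ∈ (π.add b).removableBoxes.erase b ∧ b ∈ π.addableBoxes := by
      intro c b
      simp only [Finset.mem_erase, mem_addableBoxes, mem_removableBoxes]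
      constructor
      · rintro ⟨h1, h2, h3⟩
        have := (removable_and_addable_iff h2).1 ⟨h1, h3⟩
        exact ⟨⟨h2.symm, this.2⟩, this.1⟩
      · rintro ⟨⟨h1, h2⟩, h3⟩
        have := (removable_and_addable_iff h1.symm).2 ⟨h3, h2⟩
        exact ⟨this.1, h1.symm, this.2⟩
    -- Coherence is applied at the partition $\pi-c$, to which both $b$ and $c$ can be added.
    rw [← Finset.sum_comm' hmem]
    refine Finset.sum_congr rfl fun c hc => Finset.sum_congr rfl fun b hb => ?_
    rw [mem_removableBoxes] at hc
    rw [Finset.mem_erase, mem_addableBoxes] at hb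
    rw [hE.coherent _ _ _ hb.2 (addable_remove hc) hb.1, add_remove hc,
      add_remove_comm hb.1 hc hb.2]
  rw [hoff, add_sub_add_right_eq_sub, ← sub_smul]
  congr 1
  rw [psiEigenvalue_eq_sum_residue hsum hgen, cornerBoxes, Finset.sum_union, mul_add,
    Finset.mul_sum, Finset.mul_sum, sub_eq_add_neg, ← Finset.sum_neg_distrib, add_comm]
  · congr 1
    · refine Finset.sum_congr rfl fun b hb => ?_
      rw [hE.sq _ _ (mem_addableBoxes.1 hb)]
      ring
    · refine Finset.sum_congr rfl fun c hc => ?_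
      rw [mem_removableBoxes] at hc
      -- The root is taken at $\pi-c$, and passing to the residue of $\psi_\pi$ costs a sign. It
      -- cancels the sign in the definition of $f_k$, so removable and addable boxes contribute
      -- alike.
      have hcells : π.cells = insert c (π.remove c).cells := by
        rw [← cells_add (addable_remove hc), add_remove hc]
      rw [hE.sq _ _ (addable_remove hc), residue_insert hsum hgen (addable_remove hc).1 hcells]
      ring
  · rw [Finset.disjoint_left]
    intro b hb hb'
    exact (mem_addableBoxes.1 hb).1 (mem_removableBoxes.1 hb').1

theorem ppPsi_one (hsum : h₁ + h₂ + h₃ = 0) : ppPsi h₁ h₂ h₃ 1 = 0 :=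
  end_ext fun π => by rw [ppPsi_ket, psiEigenvalue_one hsum, zero_smul, LinearMap.zero_apply]

theorem bracket_ppPsi_ppF (hsum : h₁ + h₂ + h₃ = 0) (hs : sigmaThree h₁ h₂ h₃ ≠ 0) (j : ℕ) :
    ⁅ppPsi h₁ h₂ h₃ 2, ppF h₁ h₂ h₃ E j⁆ = (-2 : ℂ) • ppF h₁ h₂ h₃ E j := by
  refine end_ext fun π => ?_
  rw [Ring.lie_def, LinearMap.sub_apply, Module.End.mul_apply, Module.End.mul_apply, ppPsi_ket,
    LinearMap.smul_apply, map_smul, ppF_ket, map_sum, Finset.smul_sum, Finset.smul_sum,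
    ← Finset.sum_sub_distrib]
  refine Finset.sum_congr rfl fun b hb => ?_
  rw [mem_removableBoxes] at hb
  rw [map_smul, ppPsi_ket, smul_smul, smul_smul, smul_smul, ← sub_smul, psiEigenvalue_two hsum hs,
    psiEigenvalue_two hsum hs, cells_remove hb]
  congr 1
  rw [Finset.card_erase_of_mem hb.1, Nat.cast_sub (Finset.card_pos.2 ⟨b, hb.1⟩)]
  push_cast
  ring

theorem pp_modeRelations (hsum : h₁ + h₂ + h₃ = 0)
    (hgen : ∀ a b : ℤ, (a : ℂ) * h₁ + (b : ℂ) * h₂ = 0 → a = 0 ∧ b = 0)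
    (hE : IsRootChoice h₁ h₂ h₃ E) :
    ModeRelations (ppE h₁ h₂ h₃ E) (ppF h₁ h₂ h₃ E) (ppPsi h₁ h₂ h₃ 1) (ppPsi h₁ h₂ h₃ 2) where
  e_f_zero := bracket_ppE_ppF hsum hgen hE 1 0
  e_f_one := bracket_ppE_ppF hsum hgen hE 1 1
  h_f_zero := bracket_ppPsi_ppF hsum (sigmaThree_ne_zero hsum hgen).2.2.2 0
  h_f_one := bracket_ppPsi_ppF hsum (sigmaThree_ne_zero hsum hgen).2.2.2 1
  e_z := by rw [ppPsi_one hsum, Ring.lie_def, mul_zero, zero_mul]; exact sub_self _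
  f_z := by rw [ppPsi_one hsum, Ring.lie_def, mul_zero, zero_mul]; exact sub_self _

theorem ppPsi_apply (j : ℕ) (v : PPSpace) (π : PlanePartition) :
    ppPsi h₁ h₂ h₃ j v π = psiEigenvalue h₁ h₂ h₃ π j * v π := by
  induction v using Finsupp.induction_linear with
  | zero => simp
  | add v w hv hw => rw [map_add, Finsupp.add_apply, hv, hw, Finsupp.add_apply, mul_add]
  | single ρ c =>
    rw [show Finsupp.single ρ c = c • ket ρ by simp [ket], map_smul, ppPsi_ket]
    by_cases h : ρ = π
    · subst h
      simp [ket, mul_comm]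
    · simp [ket, h]

/-- The modes with large positive index annihilate a given vector. -/
theorem ppBosonOne_ket_eq_zero (hsum : h₁ + h₂ + h₃ = 0)
    (hgen : ∀ a b : ℤ, (a : ℂ) * h₁ + (b : ℂ) * h₂ = 0 → a = 0 ∧ b = 0)
    (hE : IsRootChoice h₁ h₂ h₃ E) (π : PlanePartition) {i : ℤ} (hi : (π.cells.card : ℤ) < i) :
    ppBosonOne h₁ h₂ h₃ E i (ket π) = 0 := by
  have H := pp_modeRelations hsum hgen hE
  have hs := (sigmaThree_ne_zero hsum hgen).2.2.2
  obtain ⟨k, rfl⟩ : ∃ k : ℕ, i = Int.ofNat (k + 1) := ⟨(i - 1).toNat, by simp; omega⟩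
  -- The operator lowers the $\psi_2$-eigenvalue $2|\pi|$ by $2(k+1)$; a nonzero coefficient at `ρ`
  -- would require $|\rho|+k+1=|\pi|$.
  have hz : adPow (ppF h₁ h₂ h₃ E 1) k (ppF h₁ h₂ h₃ E 0) (ket π) = 0 := by
    have h := LinearMap.congr_fun (H.lie_h_adPow k) (ket π)
    rw [Ring.lie_def, LinearMap.sub_apply, Module.End.mul_apply, Module.End.mul_apply, ppPsi_ket,
      map_smul, LinearMap.smul_apply] at h
    ext ρ
    have h' := DFunLike.congr_fun h ρ
    rw [Finsupp.sub_apply, ppPsi_apply, Finsupp.smul_apply, Finsupp.smul_apply, smul_eq_mul,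
      smul_eq_mul, psiEigenvalue_two hsum hs, psiEigenvalue_two hsum hs, ← sub_eq_zero, ← sub_mul,
      ← sub_mul] at h'
    refine (mul_eq_zero.1 h').resolve_left fun h0 => ?_
    have h1 : ((ρ.cells.card + (k + 1) : ℕ) : ℂ) = (π.cells.card : ℕ) := by
      push_cast
      linear_combination h0 / 2
    have h2 := Nat.cast_injective h1
    simp at hi
    omega
  show (-((k.factorial : ℂ)⁻¹ • adPow (ppF h₁ h₂ h₃ E 1) k (ppF h₁ h₂ h₃ E 0))) (ket π) = 0
  rw [LinearMap.neg_apply, LinearMap.smul_apply, hz, smul_zero, neg_zero]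

theorem exists_ppBosonOne_eq_zero (hsum : h₁ + h₂ + h₃ = 0)
    (hgen : ∀ a b : ℤ, (a : ℂ) * h₁ + (b : ℂ) * h₂ = 0 → a = 0 ∧ b = 0)
    (hE : IsRootChoice h₁ h₂ h₃ E) (v : PPSpace) :
    ∃ M : ℕ, ∀ i : ℤ, (M : ℤ) < i → ppBosonOne h₁ h₂ h₃ E i v = 0 := by
  induction v using Finsupp.induction_linear with
  | zero => exact ⟨0, fun i _ => map_zero _⟩
  | add v w hv hw =>
    obtain ⟨M, hM⟩ := hv
    obtain ⟨N, hN⟩ := hw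
    refine ⟨max M N, fun i hi => ?_⟩
    rw [map_add, hM i (by omega), hN i (by omega), add_zero]
  | single π c =>
    refine ⟨π.cells.card, fun i hi => ?_⟩
    rw [show Finsupp.single π c = c • ket π by simp [ket], map_smul,
      ppBosonOne_ket_eq_zero hsum hgen hE π hi, smul_zero]

theorem finite_normalOrdered_ne_zero (hsum : h₁ + h₂ + h₃ = 0)
    (hgen : ∀ a b : ℤ, (a : ℂ) * h₁ + (b : ℂ) * h₂ = 0 → a = 0 ∧ b = 0)
    (hE : IsRootChoice h₁ h₂ h₃ E) (n : ℕ) (v : PPSpace) :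
    {i : ℤ | normalOrdered (ppBosonOne h₁ h₂ h₃ E) i (-(n : ℤ) - i) v ≠ 0}.Finite := by
  obtain ⟨M, hM⟩ := exists_ppBosonOne_eq_zero hsum hgen hE v
  refine (Set.finite_Icc (-(n : ℤ) - M) M).subset fun i hi => ?_
  by_contra h
  refine hi ?_
  rw [Set.mem_Icc, not_and_or, not_le, not_le] at h
  rcases h with h | h
  · rw [normalOrdered, if_neg (by omega), Module.End.mul_apply, hM _ (by omega), map_zero]
  · rw [normalOrdered, if_pos (by omega), Module.End.mul_apply, hM _ (by omega), map_zero]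

/-- The operator is defined on basis vectors, but the bracket also evaluates it at $e_1v$.
Additivity of the finite sums uses that only finitely many terms are nonzero on each vector. -/
theorem ppSpinTwo_apply (hsum : h₁ + h₂ + h₃ = 0)
    (hgen : ∀ a b : ℤ, (a : ℂ) * h₁ + (b : ℂ) * h₂ = 0 → a = 0 ∧ b = 0)
    (hE : IsRootChoice h₁ h₂ h₃ E) (n : ℕ) (v : PPSpace) :
    ppSpinTwo h₁ h₂ h₃ E n v = linearPart (sigmaThree h₁ h₂ h₃) (ppE h₁ h₂ h₃ E) n v -
      ∑ᶠ i : ℤ, normalOrdered (ppBosonOne h₁ h₂ h₃ E) i (-(n : ℤ) - i) v := by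
  rw [ppSpinTwo, LinearMap.sub_apply]
  congr 1
  induction v using Finsupp.induction_linear with
  | zero => simp
  | add v w hv hw =>
    rw [map_add, hv, hw, ← finsum_add_distrib (finite_normalOrdered_ne_zero hsum hgen hE n v)
      (finite_normalOrdered_ne_zero hsum hgen hE n w)]
    simp only [map_add]
  | single π c =>
    rw [Finsupp.linearCombination_single, show Finsupp.single π c = c • ket π by simp [ket],
      smul_finsum]
    simp only [map_smul]

theorem bracket_ppSpinTwo (hsum : h₁ + h₂ + h₃ = 0)
    (hgen : ∀ a b : ℤ, (a : ℂ) * h₁ + (b : ℂ) * h₂ = 0 → a = 0 ∧ b = 0)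
    (hE : IsRootChoice h₁ h₂ h₃ E) (k : ℕ) :
    ⁅ppE h₁ h₂ h₃ E 1, ppSpinTwo h₁ h₂ h₃ E (k + 2)⁆ =
      ((k : ℂ) + 1) • ppSpinTwo h₁ h₂ h₃ E (k + 1 + 2) := by
  have H := pp_modeRelations hsum hgen hE
  have hfin := finite_normalOrdered_ne_zero hsum hgen hE
  have hL := lie_linearPart (sigmaThree h₁ h₂ h₃) (ppE h₁ h₂ h₃ E) k
  refine LinearMap.ext fun v => ?_
  have hL' := LinearMap.congr_fun hL v
  rw [Ring.lie_def, LinearMap.sub_apply, Module.End.mul_apply, Module.End.mul_apply,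
    LinearMap.smul_apply] at hL'
  rw [Ring.lie_def, LinearMap.sub_apply, Module.End.mul_apply, Module.End.mul_apply,
    LinearMap.smul_apply, ppSpinTwo_apply hsum hgen hE, ppSpinTwo_apply hsum hgen hE,
    ppSpinTwo_apply hsum hgen hE, map_sub, smul_sub, ← hL', sub_sub_sub_comm]
  congr 1
  have hmap := (ppE h₁ h₂ h₃ E 1).toAddMonoidHom.map_finsum (hfin (k + 2) v)
  simp only [LinearMap.toAddMonoidHom_coe] at hmap
  rw [hmap, ← finsum_sub_distrib ((hfin (k + 2) v).subset fun i hi h => hi (by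
    simp only [h, map_zero])) (hfin (k + 2) _)]
  -- In the discrete topology the finite sums become convergent series, so `tsum_shift_sub` applies
  -- here as well.
  let _ : TopologicalSpace PPSpace := ⊥
  have : DiscreteTopology PPSpace := ⟨rfl⟩
  have : ContinuousConstSMul ℂ PPSpace := ⟨fun _ => continuous_of_discreteTopology⟩
  have ht := tsum_shift_sub (F := fun i : ℤ => normalOrdered (ppBosonOne h₁ h₂ h₃ E) i
    (-((k + 1 + 2 : ℕ) : ℤ) - i) v) (fun c => summable_of_hasFiniteSupport
      ((hfin (k + 1 + 2) v).subset fun i hi h => hi (by simp only [h, smul_zero]))) ((k : ℂ) + 2)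
  have hterm (i : ℤ) : ppE h₁ h₂ h₃ E 1
      (normalOrdered (ppBosonOne h₁ h₂ h₃ E) i (-((k + 2 : ℕ) : ℤ) - i) v) -
      normalOrdered (ppBosonOne h₁ h₂ h₃ E) i (-((k + 2 : ℕ) : ℤ) - i) (ppE h₁ h₂ h₃ E 1 v) =
      (-(i : ℂ)) • normalOrdered (ppBosonOne h₁ h₂ h₃ E) (i - 1)
        (-((k + 1 + 2 : ℕ) : ℤ) - (i - 1)) v +
      ((k : ℂ) + 2 + i) • normalOrdered (ppBosonOne h₁ h₂ h₃ E) i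
        (-((k + 1 + 2 : ℕ) : ℤ) - i) v := by
    have h := LinearMap.congr_fun (H.lie_normalOrdered (i := i) (j := -((k + 2 : ℕ) : ℤ) - i)
      (by push_cast; omega)) v
    rw [Ring.lie_def, LinearMap.sub_apply, Module.End.mul_apply, Module.End.mul_apply,
      LinearMap.add_apply, LinearMap.smul_apply, LinearMap.smul_apply] at h
    refine h.trans ?_
    rw [show -((k + 1 + 2 : ℕ) : ℤ) - (i - 1) = -((k + 2 : ℕ) : ℤ) - i by push_cast; ring,
      show -((k + 1 + 2 : ℕ) : ℤ) - i = -((k + 2 : ℕ) : ℤ) - i - 1 by push_cast; ring,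
      show (k : ℂ) + 2 + i = -((-((k + 2 : ℕ) : ℤ) - i : ℤ) : ℂ) by push_cast; ring]
    rfl
  have hsupp : Function.HasFiniteSupport fun i : ℤ => ppE h₁ h₂ h₃ E 1
      (normalOrdered (ppBosonOne h₁ h₂ h₃ E) i (-((k + 2 : ℕ) : ℤ) - i) v) -
      normalOrdered (ppBosonOne h₁ h₂ h₃ E) i (-((k + 2 : ℕ) : ℤ) - i)
        (ppE h₁ h₂ h₃ E 1 v) := by
    refine ((hfin (k + 2) v).union (hfin (k + 2) (ppE h₁ h₂ h₃ E 1 v))).subset fun i hi => ?_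
    by_contra h
    rw [Set.mem_union, not_or] at h
    have h1 := not_not.1 h.1
    have h2 := not_not.1 h.2
    exact hi (by simp only [h1, h2, map_zero, sub_zero])
  rw [← tsum_eq_finsum (L := .unconditional ℤ) hsupp,
    ← tsum_eq_finsum (L := .unconditional ℤ) (hfin (k + 1 + 2) v), tsum_congr hterm, ht]
  congr 1
  ring

theorem ppSpinTwo_eq_adPow (hsum : h₁ + h₂ + h₃ = 0)
    (hgen : ∀ a b : ℤ, (a : ℂ) * h₁ + (b : ℂ) * h₂ = 0 → a = 0 ∧ b = 0)
    (hE : IsRootChoice h₁ h₂ h₃ E) {n : ℕ} (hn : 2 ≤ n) :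
    ppSpinTwo h₁ h₂ h₃ E n = ((n - 2).factorial : ℂ)⁻¹ •
      adPow (ppE h₁ h₂ h₃ E 1) (n - 2) (ppSpinTwo h₁ h₂ h₃ E 2) := by
  obtain ⟨k, rfl⟩ := Nat.exists_eq_add_of_le' hn
  exact eq_inv_factorial_smul_adPow (bracket_ppSpinTwo hsum hgen hE) k

end

end AffineYangian

end

open AffineYangian in
theorem mainTheorem3 (h₁ h₂ h₃ : ℂ) (hsum : h₁ + h₂ + h₃ = 0) :
    -- in the completed Yangian, with zero mode `a_{0,1} = ψ₁`
    (∀ n : ℕ, 2 ≤ n →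
      (Summable fun i : ℤ => normalOrdered
        (bosonOne (CompletedYangian.e h₁ h₂ h₃) (CompletedYangian.f h₁ h₂ h₃)
          (CompletedYangian.psi h₁ h₂ h₃ 1)) i (-(n : ℤ) - i)) ∧
      spinTwo h₁ h₂ h₃ (CompletedYangian.psi h₁ h₂ h₃ 1) n =
        ((n - 2).factorial : ℂ)⁻¹ • adPow (CompletedYangian.e h₁ h₂ h₃ 1) (n - 2)
          (spinTwo h₁ h₂ h₃ (CompletedYangian.psi h₁ h₂ h₃ 1) 2)) ∧
    -- without zero mode: the same identity up to an explicit multiple of the central element `ψ₁`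
    (∀ n : ℕ, 2 ≤ n →
      (Summable fun i : ℤ => normalOrdered
        (bosonOne (CompletedYangian.e h₁ h₂ h₃) (CompletedYangian.f h₁ h₂ h₃) 0)
          i (-(n : ℤ) - i)) ∧
      spinTwo h₁ h₂ h₃ 0 n =
        ((n - 2).factorial : ℂ)⁻¹ • adPow (CompletedYangian.e h₁ h₂ h₃ 1) (n - 2)
          (spinTwo h₁ h₂ h₃ 0 2) -
        (2 * ((n : ℂ) - 2)) • (CompletedYangian.psi h₁ h₂ h₃ 1 *
          bosonOne (CompletedYangian.e h₁ h₂ h₃) (CompletedYangian.f h₁ h₂ h₃) 0 (-(n : ℤ)))) ∧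
    -- on plane partitions, for generic parameters
    ((∀ a b : ℤ, (a : ℂ) * h₁ + (b : ℂ) * h₂ = 0 → a = 0 ∧ b = 0) →
      ∀ E : PlanePartition → Box → ℂ, IsRootChoice h₁ h₂ h₃ E →
        ppPsi h₁ h₂ h₃ 1 = 0 ∧
        ∀ n : ℕ, 2 ≤ n →
          (∀ v : PPSpace, {i : ℤ | normalOrdered (ppBosonOne h₁ h₂ h₃ E) i (-(n : ℤ) - i) v
            ≠ 0}.Finite) ∧
          ppSpinTwo h₁ h₂ h₃ E n =
            ((n - 2).factorial : ℂ)⁻¹ • adPow (ppE h₁ h₂ h₃ E 1) (n - 2)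
              (ppSpinTwo h₁ h₂ h₃ E 2)) := by
  refine ⟨fun n hn => ⟨summable_normalOrdered h₁ h₂ h₃ (toYangian h₁ h₂ h₃ (fpsi 1)) n,
    spinTwo_eq_adPow h₁ h₂ h₃ hn⟩, fun n hn => ⟨?_, spinTwo_zero_eq_adPow h₁ h₂ h₃ hn⟩,
    fun hgen E hE => ⟨ppPsi_one hsum, fun n hn =>
      ⟨finite_normalOrdered_ne_zero hsum hgen hE n, ppSpinTwo_eq_adPow hsum hgen hE hn⟩⟩⟩
  simpa only [map_zero] using summable_normalOrdered h₁ h₂ h₃ 0 n
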